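/- **Setting.** Rows and columns of an $n\times n$ array are numbered $1,\dots,n$ from the top and from the left; "northwest" is meant weakly. A permutation $\pi$ of $[n]$ is drawn as an array with a black checker in row $\pi(c)$ of each column $c$. An ordered basis $m_1,\dots,m_n$ of $\mathbb C^n$ and $\pi$ define a pair of flags $(F,M)$ by $M_i=\langle m_1,\dots,m_i\rangle$ and $F_j=\langle m_{\pi(1)},\dots,m_{\pi(j)}\rangle$; write $M$ also for the matrix with columns $m_i$. A *checkerboard* $b$ on $\pi$ consists of $k$ red checkers in distinct rows and distinct columns, numbered from top to bottom, such that every set of $j$ of them has at least $j$ black checkers to its northwest (that is, northwest of some member of the set). For a set $S$ of red checkers let $S(F,M)$ be the span of those $m_i$ whose black checker (the one in row $i$) is northwest of $S$. The *checkerboard variety* is $$Y_b(F,M)=\{H\in \mathrm{Gr}(k,n)\mid \dim(H\cap S(F,M))\ge \#S\ \text{ for all sets } S \text{ of red checkers}\}.$$ Let $\mathcal Y_b$ be the set of complex $n\times k$ matrices $(y_{i,j})$ with $y_{i,j}=1$ if red checker $j$ is in row $i$; $y_{i,j}=0$ if the black checker in row $i$ is not northwest of red checker $j$, or shares its square with a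 different red checker; and $y_{i,j}$ arbitrary otherwise. For a set $\mathcal Z$ of $n\times k$ matrices, $\phi(M\mathcal Z)\subset\mathrm{Gr}(k,n)$ is the set of column spans of those matrices $MZ$, $Z\in\mathcal Z$, that have rank $k$. The Grassmannian has its classical topology. **The checkerboard game.** The bubble sort runs through permutations, starting at $\omega_0(c)=n+1-c$. An array $\sigma\ne 1$ in it has a descending checker, in column $d$ and the *critical row* $r<n$, such that the black checkers to the right of column $d$ (region $A$) lie on the antidiagonal and those to the left of it go down from left to right; the latter form region $B$ (rows above $r$) and region $E$ (rows below $r$). The ascending checker is the one in row $r+1$, which is the top one of $E$; let $e$ be its column. In the next array $\pi$ the descending and the ascending checker exchange rows. A root of the game, on $\omega_0$, is a checkerboard with red checkers in the squares $(\beta_{k+1-i},\alpha_i)$, $i=1,\dots,k$, for some $\alpha_1<\dots<\alpha_k$ and $\beta_1<\dots<\beta_k$ in $[n]$. The children on $\pi$ of a node $b'$ on $\sigma$ are as follows. * No red checker is in row $r$: a red checker in the square $(r+1,e)$ moves to $(r,e)$; if there is none, all red checkers stay. * There is a red checker in row $r$, in column $c$, but none in the square of a black checker of $E$: if $c=d$,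 the red checker $(r,d)$ moves to $(r,e)$; otherwise all stay. * There is a red checker in row $r$, in column $c$, and the top red checker in the square of a black checker of $E$ is at $(R,c')$. If $c=d$ or $c'=e$, the move is a *swap*: the two red checkers go to $(r,e)$ and $(R,c)$. If $c\ne d$ and $c'\neq e$, there is a child in which all stay, and, if no red checker lies in a row strictly between $r$ and $R$ and a column strictly between $c'$ and $c$, also a child by a swap. **Modified coordinates.** Let $b'$ (the parent), on $\sigma$, be a node of the game and let $b$ (the child), on $\pi$, be obtained from it by a swap. Let $s$ be the number of the red checker in row $r$ and $s'$ that of the other moving one, in row $R$ (in fact $s'=s+1$). Let $m_1,\dots,m_n$ be an ordered basis of $\mathbb C^n$, and let $(F,M)$ be the pair of flags that it defines with $\pi$. For $t\in\mathbb C\setminus\{0\}$ let $M'(t)$ be the flag of the ordered basis $m'_r(t)=m_r-t\,m_{r+1}$, $m'_{r+1}(t)=m_r$, $m'_i(t)=m_i$ for $i\ne r,r+1$; and let $M'(0)=M$. For $y\in\mathcal Y_b$ let $y(t)$ be the matrix that agrees with $y$ except in column $s$, where $$y_{r,s}(t)=y_{r+1,s'},\qquad y_{r+1,s}(t)=-t\,y_{r+1,s'},\qquad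 y_{a,s}(t)=-t\,y_{a,s'},\qquad y_{u,s}(t)=y_{r+1,s'}\,y_{u,s},$$ for rows $a$ of black checkers in $A$ and rows $u$ of black checkers in $B$, and $y_{i,s}(t)=0$ for all other $i$. Let $\mathcal Y(t)=\{y(t)\mid y\in\mathcal Y_b\}$. **Lemma 3.3 (Case III).** For every $t\neq 0$, $\phi(M\mathcal Y(t))$ is a dense subset of the parent checkerboard variety $Y_{b'}(F,M'(t))$; and $\phi(M\mathcal Y(0))$ is a dense subset of the child checkerboard variety $Y_b(F,M'(0))=Y_b(F,M)$. -/

import Mathlib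

noncomputable section

namespace LRHomotopy

/-! ### The Grassmannian as the space of column spans of full-rank matrices -/

/-- The Stiefel manifold `M_{k,n}` of `n × k` complex matrices of rank `k`, with the topology
of a subspace of the space of all matrices. -/
abbrev Stiefel (k n : ℕ) : Type := {X : Matrix (Fin n) (Fin k) ℂ // X.rank = k}

/-- The Grassmannian `Gr(k,n)` of `k`-dimensional linear subspaces of `ℂⁿ`. -/
def Gr (k n : ℕ) : Type := {H : Submodule ℂ (Fin n → ℂ) // Module.finrank ℂ H = k}

/-- The map `φ` that takes a matrix of rank `k` to its column span. -/
def φ {k n : ℕ} (X : Stiefel k n) : Gr k n := ⟨LinearMap.range X.1.mulVecLin, X.2⟩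

/-- The Grassmannian carries its classical topology, the quotient topology for `φ`. -/
instance (k n : ℕ) : TopologicalSpace (Gr k n) := TopologicalSpace.coinduced φ inferInstance

/-- `φ(M 𝒴)`: the `k`-planes that are column spans of the matrices `M Y` of rank `k`,
where `Y` is in `𝒴`. -/
def planes {k n : ℕ} (M : Matrix (Fin n) (Fin n) ℂ) (𝒴 : Set (Matrix (Fin n) (Fin k) ℂ)) :
    Set (Gr k n) :=
  φ '' {X : Stiefel k n | ∃ Y ∈ 𝒴, X.1 = M * Y}

/-- `A` is a dense subset of `Y`. -/
def IsDenseIn {X : Type} [TopologicalSpace X] (A Y : Set X) : Prop := A ⊆ Y ∧ Y ⊆ closure A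

/-! ### Flags and relative position -/

/-- The sequence of spans of the first columns of a matrix. Entry `j` is the span of the columns
`0, …, j`, so for an invertible matrix it is the `(j+1)`-dimensional member of the flag. -/
def flagOf {n : ℕ} (M : Matrix (Fin n) (Fin n) ℂ) (j : Fin n) : Submodule ℂ (Fin n → ℂ) :=
  Submodule.span ℂ (M.col '' Set.Iic j)

/-- The columns of `m` are an ordered basis `m_i` which, together with the permutation `π`,
defines the pair of flags `(F, G)`: the `i`-th space of `G` is spanned by the first
`i` basis vectors, and the `j`-th space of `F` by the vectors `m_{π(c)}` for the first `j`
columns `c`. In the permutation array the black checker of column `c` is in row `π c`, and the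
black checker in row `i` stands for `m_i`. -/
def DefinesPair {n : ℕ} (π : Equiv.Perm (Fin n)) (m : Matrix (Fin n) (Fin n) ℂ)
    (F G : Fin n → Submodule ℂ (Fin n → ℂ)) : Prop :=
  IsUnit m.det ∧ G = flagOf m ∧ F = flagOf (m.submatrix id π)

/-! ### Checkerboards and checkerboard varieties -/

/-- A placement of `k` red checkers in distinct rows and distinct columns of an `n × n` array,
listed from top to bottom. Rows and columns are numbered from `0`, from the top and the left. -/
structure RedCheckers (n k : ℕ) where
  row : Fin k → Fin n
  col : Fin k → Fin n
  row_strictMono : StrictMono row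
  col_injective : Function.Injective col

/-- The black checker in column `c` is (weakly) northwest of red checker `j`. -/
def BlackNW {n k : ℕ} (π : Equiv.Perm (Fin n)) (b : RedCheckers n k) (c : Fin n) (j : Fin k) :
    Prop :=
  c ≤ b.col j ∧ π c ≤ b.row j

/-- The placement `b` is a checkerboard on the permutation array `π`: any subset of `j`
red checkers has at least `j` black checkers to its northwest. -/
def IsCheckerboard {n k : ℕ} (π : Equiv.Perm (Fin n)) (b : RedCheckers n k) : Prop :=
  ∀ S : Finset (Fin k), S.card ≤ {c : Fin n | ∃ j ∈ S, BlackNW π b c j}.ncard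

/-- The subspace `S(F,G)` spanned by the black checkers northwest of the set `S` of red checkers,
where the black checkers stand for the columns of `m`. -/
def blackSpan {n k : ℕ} (π : Equiv.Perm (Fin n)) (b : RedCheckers n k)
    (m : Matrix (Fin n) (Fin n) ℂ) (S : Finset (Fin k)) : Submodule ℂ (Fin n → ℂ) :=
  Submodule.span ℂ {v | ∃ c, (∃ j ∈ S, BlackNW π b c j) ∧ v = m.col (π c)}

/-- The checkerboard variety `Y_b(F,G)` of a pair of flags with relative position `π`: all
`k`-planes `H` with `dim (H ∩ S(F,G)) ≥ #S` for every set `S` of red checkers. The spaces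
`S(F,G)` do not depend on the basis `m` that defines the pair `(F,G)`, as the span of the black
checkers in the first rows and columns is the intersection of the two members of the flags. -/
def checkerboardVariety {n k : ℕ} (π : Equiv.Perm (Fin n)) (b : RedCheckers n k)
    (F G : Fin n → Submodule ℂ (Fin n → ℂ)) : Set (Gr k n) :=
  {H | ∃ m : Matrix (Fin n) (Fin n) ℂ, DefinesPair π m F G ∧
    ∀ S : Finset (Fin k),
      S.card ≤ Module.finrank ℂ (H.1 ⊓ blackSpan π b m S : Submodule ℂ (Fin n → ℂ))}

/-- The set `𝒴_b` of reduced echelon matrices. The entry in row `i` of column `j` is `1` if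
red checker `j` is in row `i`; it is `0` if the black checker in row `i` is not northwest of red
checker `j`, or shares its square with a different red checker; otherwise it is arbitrary. -/
def stiefelCoords {n k : ℕ} (π : Equiv.Perm (Fin n)) (b : RedCheckers n k) :
    Set (Matrix (Fin n) (Fin k) ℂ) :=
  {y | ∀ i j,
    (b.row j = i → y i j = 1) ∧
    (b.row j ≠ i →
      (¬ BlackNW π b (π.symm i) j ∨ ∃ l, l ≠ j ∧ b.row l = i ∧ b.col l = π.symm i) →
      y i j = 0)}

/-! ### The checkerboard game -/

/-- The permutation array `σ` in the bubble sort, before the move in which the descending black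
checker in column `d` leaves the critical row `r` for the next row `r'`. To the right of column
`d`, the black checkers (region A) are on the antidiagonal; those to the left of column `d`
(regions B, above row `r`, and E, below row `r`) go down from left to right. As row `r'` exists,
region E is not empty, and its top checker, the ascending one, is in row `r'`. -/
structure MidSort {n : ℕ} (σ : Equiv.Perm (Fin n)) (d r r' : Fin n) : Prop where
  regionA : ∀ c, d < c → (σ c : ℕ) + c + 1 = n
  descending : σ d = r
  regionBE : StrictMonoOn σ (Set.Iio d)
  next : (r' : ℕ) = r + 1

/-- The next permutation array in the bubble sort: the black checkers in the rows
`r` and `r'` of `σ` exchange their rows. -/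
def nextPerm {n : ℕ} (σ : Equiv.Perm (Fin n)) (r r' : Fin n) : Equiv.Perm (Fin n) :=
  Equiv.swap r r' * σ

/-- Red checker `j` is in the critical diagonal, that is, in the square of a black checker in
region E. -/
def OnCriticalDiagonal {n k : ℕ} (σ : Equiv.Perm (Fin n)) (d r : Fin n) (b : RedCheckers n k)
    (j : Fin k) : Prop :=
  b.col j < d ∧ r < b.row j ∧ σ (b.col j) = b.row j

/-- Red checker `j` is the top red checker in the critical diagonal. -/
def IsTopOnCriticalDiagonal {n k : ℕ} (σ : Equiv.Perm (Fin n)) (d r : Fin n)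
    (b : RedCheckers n k) (j : Fin k) : Prop :=
  OnCriticalDiagonal σ d r b j ∧ ∀ l, OnCriticalDiagonal σ d r b l → b.row j ≤ b.row l

/-- Red checker `l` is a blocker: it lies in the rectangle between red checker `s` in the
critical row and red checker `s'` in the critical diagonal. -/
def IsBlocker {n k : ℕ} (b : RedCheckers n k) (s s' l : Fin k) : Prop :=
  b.row s < b.row l ∧ b.row l < b.row s' ∧ b.col s' < b.col l ∧ b.col l < b.col s

/-- The swap moves of the checkerboard game. There is a red checker `s` in the critical row, and
`s'` is the top red checker in the critical diagonal. Both keep their rows. Red checker `s'` moves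
to the column of `s`, and `s` moves to the new square (in row `r`) of the ascending black checker.
This covers all four situations: red checker `s` in the square of the descending checker or not,
and red checker `s'` in the square of the ascending checker or not. If neither is, then a swap
is only allowed when there is no blocker. -/
structure SwapMove {n k : ℕ} (σ : Equiv.Perm (Fin n)) (d r r' : Fin n) (s s' : Fin k)
    (parent child : RedCheckers n k) : Prop where
  critical : parent.row s = r
  top : IsTopOnCriticalDiagonal σ d r parent s'
  no_blocker : parent.col s ≠ d → parent.col s' ≠ σ.symm r' → ∀ l, ¬ IsBlocker parent s s' l
  row_eq : child.row = parent.row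
  col_eq : child.col =
    Function.update (Function.update parent.col s (σ.symm r')) s' (parent.col s)

/-- The moves of the checkerboard game other than swaps. -/
inductive OtherMove {n k : ℕ} (σ : Equiv.Perm (Fin n)) (d r r' : Fin n) :
    RedCheckers n k → RedCheckers n k → Prop
  /-- No red checker in the critical row, and red checker `j` in the square of the
  ascending black checker: it moves up with that black checker. -/
  | ascend (parent child : RedCheckers n k) (j : Fin k) :
      (∀ l, parent.row l ≠ r) → parent.row j = r' → parent.col j = σ.symm r' →
      child.row = Function.update parent.row j r → child.col = parent.col →
      OtherMove σ d r r' parent child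
  /-- No red checker in the critical row or in the square of the ascending black checker. -/
  | stayEmptyRow (parent : RedCheckers n k) :
      (∀ l, parent.row l ≠ r) →
      (∀ j, ¬ (parent.row j = r' ∧ parent.col j = σ.symm r')) →
      OtherMove σ d r r' parent parent
  /-- Red checker `s` in the square of the descending black checker, and no red checker in the
  critical diagonal: `s` moves left to the new square of the ascending black checker. -/
  | left (parent child : RedCheckers n k) (s : Fin k) :
      parent.row s = r → parent.col s = d → (∀ l, ¬ OnCriticalDiagonal σ d r parent l) →
      child.row = parent.row → child.col = Function.update parent.col s (σ.symm r') →
      OtherMove σ d r r' parent child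
  /-- Red checker `s` elsewhere in the critical row, and no red checker in the critical
  diagonal. -/
  | stayEmptyDiagonal (parent : RedCheckers n k) (s : Fin k) :
      parent.row s = r → parent.col s ≠ d → (∀ l, ¬ OnCriticalDiagonal σ d r parent l) →
      OtherMove σ d r r' parent parent
  /-- Red checker `s` elsewhere in the critical row, and the top red checker in the critical
  diagonal not in the square of the ascending black checker: the red checkers may stay. -/
  | stay (parent : RedCheckers n k) (s j : Fin k) :
      parent.row s = r → parent.col s ≠ d → IsTopOnCriticalDiagonal σ d r parent j →
      parent.col j ≠ σ.symm r' →
      OtherMove σ d r r' parent parent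

/-- The nodes of checkerboard games. A root is a checkerboard on the permutation array `ω₀` given
by two brackets `α` and `β`, with red checkers in the positions `(β_{k+1-i}, α_i)`. A node on the
array `σ` has its children on the next array in the bubble sort. -/
inductive GameNode {n k : ℕ} : Equiv.Perm (Fin n) → RedCheckers n k → Prop
  | root (α β : Fin k → Fin n) (hα : StrictMono α) (hβ : StrictMono β) (b : RedCheckers n k) :
      (∀ i, b.row (Fin.rev i) = β (Fin.rev i) ∧ b.col (Fin.rev i) = α i) →
      IsCheckerboard Fin.revPerm b → GameNode Fin.revPerm b
  | swap (σ : Equiv.Perm (Fin n)) (d r r' : Fin n) (s s' : Fin k)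
      (parent child : RedCheckers n k) :
      GameNode σ parent → MidSort σ d r r' → SwapMove σ d r r' s s' parent child →
      GameNode (nextPerm σ r r') child
  | other (σ : Equiv.Perm (Fin n)) (d r r' : Fin n) (parent child : RedCheckers n k) :
      GameNode σ parent → MidSort σ d r r' → OtherMove σ d r r' parent child →
      GameNode (nextPerm σ r r') child

/-! ### The moving flag and the modified coordinates -/

/-- The moving basis `M'(t)`: for `t ≠ 0` its columns are those of `M`, except that column `r` is
`m_r - t m_{r+1}` and column `r + 1` is `m_r`; and `M'(0) = M`. Here `r'` is `r + 1`. -/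
def movingBasis {n : ℕ} (M : Matrix (Fin n) (Fin n) ℂ) (r r' : Fin n) (t : ℂ) :
    Matrix (Fin n) (Fin n) ℂ :=
  if t = 0 then M else (M.updateCol r (M.col r - t • M.col r')).updateCol r' (M.col r)

/-- The matrix with the entries `y_{i,j}(t)`. Only column `s` changes. The regions A and B
are those of the black checkers of `σ`, which is in column `σ.symm i` of row `i`. The last case
is that of the rows of region E other than `r' = r + 1`. -/
def modifiedMatrix {n k : ℕ} (σ : Equiv.Perm (Fin n)) (d r r' : Fin n) (s s' : Fin k) (t : ℂ)
    (y : Matrix (Fin n) (Fin k) ℂ) : Matrix (Fin n) (Fin k) ℂ :=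
  Matrix.of fun i j =>
    if j = s then
      if i = r then y r' s'
      else if i = r' then -t * y r' s'
      else if d < σ.symm i then -t * y i s'
      else if σ.symm i < d ∧ i < r then y r' s' * y i s
      else 0
    else y i j

/-- The modified coordinates `𝒴(t)`, for a child checkerboard obtained by a swap move from a
checkerboard on the array `σ`. -/
def modifiedCoords {n k : ℕ} (σ : Equiv.Perm (Fin n)) (d r r' : Fin n) (s s' : Fin k)
    (child : RedCheckers n k) (t : ℂ) : Set (Matrix (Fin n) (Fin k) ℂ) :=
  modifiedMatrix σ d r r' s s' t '' stiefelCoords (nextPerm σ r r') child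

end LRHomotopy

end

open Filter Topology Module

namespace LRHomotopy

/-! The red checkers of a game node have a bitonic shape: left of column `d` they sit on black
checkers that go down from left to right, and from column `d` on they go up. So the sets `N_j` of
black checkers northwest of red checker `j`, listed by columns, satisfy `N_a ∩ N_c ⊆ N_b` for `a ≤ b
≤ c`. For such families, linear algebra shows that the inequalities `dim (H ∩ S) ≥ #S`, even just
for unions `S` of an initial and a final segment of columns, place `H` in the closure of the planes
having a basis with `j`-th vector in the span of `N_j` (`mem_closure_adapted`,
`checkerboardVariety_subset_closure`). Neither a dimension count nor irreducibility enters.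
Conversely, planes with such a basis satisfy the inequalities (`planes_supportCoords_subset`).

It remains to compare the planes of `y(t)` with planes of prescribed support: that of the child in
the basis `M` if `t = 0`, that of the parent in the moving basis if `t ≠ 0`. For `t = 0`, column `s`
is only multiplied by the entry `y_{r+1,s'}`. For `t ≠ 0`, adding `t⁻¹` times column `s` to column
`s'` cancels the entries in region A and in row `r+1`, which leaves the support of the parent. In
the opposite direction, a matrix with the right support, nonzero pivots and nonzero entry `(r+1,
s')` is brought to echelon form, and `y` is solved for explicitly
(`planes_subset_modifiedCoords_zero`, `planes_subset_modifiedCoords`). These generic matrices are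
dense among all with that support. -/

/-! ### Linear maps adapted to a family of supports with the betweenness property. -/

/-- The coordinate subspace of vectors supported in `T`. -/
def coordSubspace {ι : Type*} (T : Set ι) : Submodule ℂ (ι → ℂ) where
  carrier := {f | ∀ l, l ∉ T → f l = 0}
  add_mem' := fun hf hg l hl => by simp [hf l hl, hg l hl]
  zero_mem' := fun _ _ => rfl
  smul_mem' := fun c f hf l hl => by simp [hf l hl]

theorem coordSubspace_mono {ι : Type*} {T T' : Set ι} (h : T ⊆ T') :
    coordSubspace T ≤ coordSubspace T' := fun _ hf l hl => hf l fun h' => hl (h h')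

theorem coordSubspace_inf {ι : Type*} {T T' : Set ι} {f : ι → ℂ}
    (h : f ∈ coordSubspace T) (h' : f ∈ coordSubspace T') : f ∈ coordSubspace (T ∩ T') := by
  intro l hl
  by_cases hT : l ∈ T
  · exact h' l fun hT' => hl ⟨hT, hT'⟩
  · exact h l hT

/-- The union of the sets `N i` with `i < m` or `j ≤ i < k`. -/
def outerUnion {ι : Type*} (N : ℕ → Set ι) (k m j : ℕ) : Set ι :=
  {l | ∃ i, l ∈ N i ∧ i < k ∧ (i < m ∨ j ≤ i)}

/-- The functions underlying the linear maps `Y : V → ℂ^ι` for which there are `k` independent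
vectors whose images are supported in `N 0, …, N (k - 1)`. -/
def adapted {ι : Type*} (V : Type) [AddCommGroup V] [Module ℂ V] (N : ℕ → Set ι) (k : ℕ) :
    Set (V → ι → ℂ) :=
  {f | ∃ Y : V →ₗ[ℂ] (ι → ℂ), f = Y ∧ ∃ v : Fin k → V, LinearIndependent ℂ v ∧
    ∀ j : Fin k, Y (v j) ∈ coordSubspace (N j)}

/-- Greedy choice: `Λ k ⊆ E k ⊆ E (k + 1)` and `E (k + 1)` has larger dimension than `Λ k`, so one
more vector is available in it. -/
theorem exists_flag {V : Type*} [AddCommGroup V] [Module ℂ V] [FiniteDimensional ℂ V]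
    (E : ℕ → Submodule ℂ V) (hE : Monotone E) (k : ℕ) (hk : ∀ m ≤ k, m ≤ finrank ℂ (E m)) :
    ∃ Λ : ℕ → Submodule ℂ V, Monotone Λ ∧ ∀ m ≤ k, finrank ℂ (Λ m) = m ∧ Λ m ≤ E m := by
  induction k with
  | zero => exact ⟨fun _ => ⊥, fun _ _ _ => le_rfl, fun m hm => by
      obtain rfl : m = 0 := by omega
      simp⟩
  | succ k ih =>
    obtain ⟨Λ, hmono, hΛ⟩ := ih fun m hm => hk m (by omega)
    have hlt : Λ k < E (k + 1) := by
      refine lt_of_le_of_ne ((hΛ k le_rfl).2.trans (hE (by omega))) fun h => ?_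
      have h1 := hk (k + 1) le_rfl
      rw [← h, (hΛ k le_rfl).1] at h1
      omega
    obtain ⟨v, hv, hv'⟩ := SetLike.exists_of_lt hlt
    refine ⟨fun m => if m ≤ k then Λ m else Λ k ⊔ ℂ ∙ v, ?_, ?_⟩
    · intro a b hab
      by_cases hb : b ≤ k
      · simpa [hb, hab.trans hb] using hmono hab
      · by_cases ha : a ≤ k
        · simpa [hb, ha] using (hmono ha).trans le_sup_left
        · simp [hb, ha]
    · intro m hm
      by_cases hmk : m ≤ k
      · beta_reduce
        rw [if_pos hmk]
        exact hΛ m hmk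
      · obtain rfl : m = k + 1 := by omega
        have h0 : v ≠ 0 := fun h => hv' (h ▸ zero_mem _)
        have hd : Disjoint (Λ k) (ℂ ∙ v) :=
          (Submodule.disjoint_span_singleton' h0).2 hv'
        have := Submodule.finrank_sup_add_finrank_inf_eq (Λ k) (ℂ ∙ v)
        rw [hd.eq_bot, finrank_bot, finrank_span_singleton h0, (hΛ k le_rfl).1] at this
        beta_reduce
        rw [if_neg hmk]
        exact ⟨by omega, sup_le ((hΛ k le_rfl).2.trans (hE (by omega)))
          ((Submodule.span_singleton_le_iff_mem _ _).2 hv)⟩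

/-- A linear form that vanishes on a subspace and takes the value `1` at a vector outside. -/
theorem exists_form {V : Type*} [AddCommGroup V] [Module ℂ V] {W : Submodule ℂ V} {u : V}
    (hu : u ∉ W) : ∃ ξ : V →ₗ[ℂ] ℂ, (∀ v ∈ W, ξ v = 0) ∧ ξ u = 1 := by
  obtain ⟨f, hf, hW⟩ := Submodule.exists_le_ker_of_notMem hu
  refine ⟨(f u)⁻¹ • f, fun v hv => ?_, by simp [hf]⟩
  have : f v = 0 := hW hv
  simp [this]

/-- Extension of approximations from a hyperplane. -/
theorem mem_closure_adapted_of_hyperplane {ι : Type*} {V : Type} [AddCommGroup V] [Module ℂ V]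
    [FiniteDimensional ℂ V] {k : ℕ} (hV : finrank ℂ V = k + 1) (N : ℕ → Set ι)
    (X : V →ₗ[ℂ] (ι → ℂ)) (K : Submodule ℂ V) (hK : finrank ℂ K = k)
    {u : V} (huN : X u ∈ coordSubspace (N k)) (hu : u ∉ K)
    (h : (⇑(X.domRestrict K) : K → ι → ℂ) ∈ closure (adapted K N k)) :
    (⇑X : V → ι → ℂ) ∈ closure (adapted V N (k + 1)) := by
  obtain ⟨ξ, hξ, hξu⟩ := exists_form hu
  have hker : ∀ v, ξ v = 0 → v ∈ K := by
    have h1 : K ≤ LinearMap.ker ξ := fun v hv => hξ v hv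
    have h2 : finrank ℂ (LinearMap.ker ξ) = k := by
      have h3 := LinearMap.finrank_range_add_finrank_ker ξ
      have h4 : LinearMap.range ξ = ⊤ := by
        rw [LinearMap.range_eq_top]
        intro c
        exact ⟨c • u, by simp [hξu]⟩
      rw [h4, finrank_top, finrank_self] at h3
      omega
    have h5 := Submodule.eq_of_le_of_finrank_eq h1 (hK.trans h2.symm)
    intro v hv
    rw [h5]
    exact hv
  let p : V →ₗ[ℂ] K := LinearMap.codRestrict K (LinearMap.id - ξ.smulRight u)
    fun v => hker _ (by simp [hξu])
  have hp : ∀ v, ((p v : K) : V) = v - ξ v • u := fun v => rfl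
  have hpK : ∀ v : K, p v = v := fun v => Subtype.ext (by rw [hp, hξ _ v.2]; simp)
  have hpu : p u = 0 := Subtype.ext (by rw [hp, hξu]; simp)
  -- Project to `K` along `u`, approximate there, and keep the value at `u`.
  let Φ : (K → ι → ℂ) → (V → ι → ℂ) := fun f v => f (p v) + ξ v • X u
  have hΦ : Continuous Φ :=
    continuous_pi fun v => (continuous_apply (p v)).add continuous_const
  have hX : Φ (X.domRestrict K) = X := by
    funext v
    simp [Φ, hp]
  rw [← hX]
  refine map_mem_closure hΦ h ?_
  rintro f ⟨Y, rfl, v, hv, hvN⟩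
  refine ⟨Y ∘ₗ p + ξ.smulRight (X u), rfl, Fin.snoc (fun j => (v j : V)) u, ?_, ?_⟩
  · refine linearIndependent_finSnoc.2 ⟨hv.map' K.subtype (Submodule.ker_subtype K), fun hmem => ?_⟩
    refine hu (Submodule.span_le.2 ?_ hmem)
    rintro _ ⟨j, rfl⟩
    exact (v j).2
  · intro j
    refine Fin.lastCases ?_ (fun i => ?_) j
    · simpa [hpu, hξu] using huN
    · simpa [hpK, hξ _ (v i).2] using hvN i

/-- A vector `u` with `X u` supported in `N k` may lie in the hyperplane `Λ k`, and then it cannot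
complete a basis of `Λ k`. An arbitrarily small perturbation of `X` and of the flag pushes `u` out
of one more member of the flag, and `q` counts the pushes left until the good case `hrec`. The
perturbation has values supported in `N k`, so it respects the position of `X u` and the rank
conditions with `j ≤ k`, whose unions all contain `N k`. -/
theorem mem_closure_adapted_of_notMem_flag {ι : Type*} {V : Type} [AddCommGroup V] [Module ℂ V]
    [FiniteDimensional ℂ V] {k : ℕ} (hV : finrank ℂ V = k + 1) (N : ℕ → Set ι)
    (hrec : ∀ (X : V →ₗ[ℂ] (ι → ℂ)) (Λ : ℕ → Submodule ℂ V), Monotone Λ →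
      (∀ m ≤ k, finrank ℂ (Λ m) = m ∧ Λ m ≤ (coordSubspace (outerUnion N k m k)).comap X) →
      (∀ m j, m ≤ j → j ≤ k →
        m + (k + 1 - j) ≤ finrank ℂ ((coordSubspace (outerUnion N (k + 1) m j)).comap X)) →
      ∀ u, X u ∈ coordSubspace (N k) → u ∉ Λ k →
        (⇑X : V → ι → ℂ) ∈ closure (adapted V N (k + 1)))
    (q m₀ : ℕ) (hq : m₀ + q = k) :
    ∀ (X : V →ₗ[ℂ] (ι → ℂ)) (Λ : ℕ → Submodule ℂ V), Monotone Λ →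
      (∀ m ≤ k, finrank ℂ (Λ m) = m ∧ Λ m ≤ (coordSubspace (outerUnion N k m k)).comap X) →
      (∀ m j, m ≤ j → j ≤ k →
        m + (k + 1 - j) ≤ finrank ℂ ((coordSubspace (outerUnion N (k + 1) m j)).comap X)) →
      ∀ u, X u ∈ coordSubspace (N k) → u ∉ Λ m₀ →
        (⇑X : V → ι → ℂ) ∈ closure (adapted V N (k + 1)) := by
  induction q generalizing m₀ with
  | zero =>
    obtain rfl : m₀ = k := by omega
    exact hrec
  | succ q ih =>
    intro X Λ hmono hΛ hW u huN hu
    have ih := ih (m₀ + 1) (by omega)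
    by_cases hu1 : u ∉ Λ (m₀ + 1)
    · exact ih X Λ hmono hΛ hW u huN hu1
    rw [not_not] at hu1
    -- By the rank condition for `(m₀ + 1, k)` this space has dimension at least `m₀ + 2`.
    obtain ⟨w, hw, hwΛ⟩ : ∃ w ∈ (coordSubspace (outerUnion N (k + 1) (m₀ + 1) k)).comap X,
        w ∉ Λ (m₀ + 1) := by
      by_contra! hcon
      have h1 := Submodule.finrank_mono (show _ ≤ Λ (m₀ + 1) from hcon)
      have h2 := hW (m₀ + 1) k (by omega) le_rfl
      have h3 := (hΛ (m₀ + 1) (by omega)).1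
      omega
    have hnot : u ∉ Λ m₀ ⊔ ℂ ∙ w := by
      intro hmem
      obtain ⟨v, hv, z, hz, hvz⟩ := Submodule.mem_sup.1 hmem
      obtain ⟨c, rfl⟩ := Submodule.mem_span_singleton.1 hz
      have hc : c ≠ 0 := by
        rintro rfl
        exact hu (by simpa [← hvz] using hv)
      refine hwΛ ?_
      have : w = c⁻¹ • (u - v) := by
        rw [← hvz, add_sub_cancel_left, smul_smul, inv_mul_cancel₀ hc, one_smul]
      rw [this]
      exact Submodule.smul_mem _ _ (Submodule.sub_mem _ hu1 (hmono (Nat.le_succ _) hv))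
    obtain ⟨ξ, hξ, hξu⟩ := exists_form hnot
    have hξΛ : ∀ v ∈ Λ m₀, ξ v = 0 := fun v hv => hξ v (Submodule.mem_sup_left hv)
    have hξw : ξ w = 0 := hξ w (Submodule.mem_sup_right (Submodule.mem_span_singleton_self w))
    classical
    let Z : Set ι := outerUnion N k (m₀ + 1) k
    -- Cancels the part of `X w` outside `N 0, …, N m₀`; that part is supported in `N k`.
    let w0 : ι → ℂ := fun l => if l ∈ Z then 0 else -X w l
    have hw0 : w0 ∈ coordSubspace (N k) := by
      intro l hl
      by_cases hZ : l ∈ Z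
      · simp [w0, hZ]
      · have : X w l = 0 := by
          refine hw l ?_
          rintro ⟨i, hi, hik, him⟩
          rcases Nat.lt_succ_iff_lt_or_eq.1 hik with h | rfl
          · exact hZ ⟨i, hi, h, him⟩
          · exact hl hi
        simp [w0, hZ, this]
    let Xε : ℂ → (V →ₗ[ℂ] (ι → ℂ)) := fun ε => X + ξ.smulRight (ε • w0)
    have hXε : ∀ ε v l, Xε ε v l = X v l + ξ v * (ε * w0 l) := fun ε v l => by simp [Xε]
    have key : ∀ ε : ℂ, ε ≠ 0 → (⇑(Xε ε) : V → ι → ℂ) ∈ closure (adapted V N (k + 1)) := by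
      intro ε hε
      have hξεw : ξ (ε • w) = 0 := by simp [hξw]
      -- Moving the flag by `G` compensates the perturbation: `Xε ε (G v)` differs from `X v` by a
      -- multiple of the restriction of `X w` to `Z`. As `ξ` vanishes on `Λ m₀`, only the members
      -- beyond it move, and `Λ (m₀ + 1)` moves off `u`.
      let G : V ≃ₗ[ℂ] V := LinearEquiv.transvection hξεw
      have hG : ∀ v, G v = v + ξ v • ε • w := fun v => rfl
      refine ih (Xε ε) (fun m => (Λ m).map (G : V →ₗ[ℂ] V))
        (fun a b hab => Submodule.map_mono (hmono hab)) (fun m hm => ⟨?_, ?_⟩) ?_ u ?_ ?_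
      · exact (LinearEquiv.finrank_map_eq G (Λ m)).trans (hΛ m hm).1
      · rintro _ ⟨v, hv, rfl⟩ l hl
        have hXv : X v l = 0 := (hΛ m hm).2 hv l hl
        change Xε ε (G v) l = 0
        rw [hXε, hG]
        have : ξ (v + ξ v • ε • w) = ξ v := by simp [hξw]
        rw [this]
        rcases Nat.lt_or_ge m₀ m with h | h
        · have hZ : l ∉ Z := by
            rintro ⟨i, hi, hik, him⟩
            exact hl ⟨i, hi, hik, by omega⟩
          simp [w0, hZ, hXv]
        · have : ξ v = 0 := hξΛ v (hmono h hv)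
          simp [this, hXv]
      · intro m j hmj hjk
        refine (hW m j hmj hjk).trans (Submodule.finrank_mono fun v hv l hl => ?_)
        have h1 : X v l = 0 := hv l hl
        have h2 : w0 l = 0 := hw0 l fun h => hl ⟨k, h, by omega, by omega⟩
        simp [hXε, h1, h2]
      · intro l hl
        simp [hXε, huN l hl, hw0 l hl]
      · rintro ⟨v, hv, hvu⟩
        have hvu : v + ξ v • ε • w = u := hvu
        have h1 : ξ v = 1 := by
          have := congrArg ξ hvu
          simpa [hξw, hξu] using this
        rw [h1, one_smul] at hvu
        refine hwΛ ?_
        have : w = ε⁻¹ • (u - v) := by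
          rw [← hvu, add_sub_cancel_left, smul_smul, inv_mul_cancel₀ hε, one_smul]
        rw [this]
        exact Submodule.smul_mem _ _ (Submodule.sub_mem _ hu1 hv)
    have hlim : Tendsto (fun ε : ℂ => (⇑(Xε ε) : V → ι → ℂ)) (𝓝[≠] 0) (𝓝 ⇑X) := by
      have hc : Continuous fun ε : ℂ => (⇑(Xε ε) : V → ι → ℂ) := by
        refine continuous_pi fun v => continuous_pi fun l => ?_
        simp only [hXε]
        fun_prop
      have h0 : (⇑(Xε 0) : V → ι → ℂ) = X := by
        funext v l
        simp [hXε]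
      have := (hc.tendsto 0).mono_left (nhdsWithin_le_nhds (s := {0}ᶜ))
      rwa [h0] at this
    exact isClosed_closure.mem_of_tendsto hlim (eventually_nhdsWithin_of_forall key)

/-- If the sets `N i` have the betweenness property `N a ∩ N c ⊆ N b` for `a ≤ b ≤ c`, the rank
conditions for the unions of their initial and final parts define the closure of the adapted
linear maps. -/
theorem mem_closure_adapted {ι : Type*} (N : ℕ → Set ι) (k : ℕ)
    (hN : ∀ a b c, a ≤ b → b ≤ c → c < k → N a ∩ N c ⊆ N b) :
    ∀ (V : Type) [AddCommGroup V] [Module ℂ V] [FiniteDimensional ℂ V], finrank ℂ V = k →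
    ∀ X : V →ₗ[ℂ] (ι → ℂ),
    (∀ m j, m ≤ j → j ≤ k →
      m + (k - j) ≤ finrank ℂ ((coordSubspace (outerUnion N k m j)).comap X)) →
    (⇑X : V → ι → ℂ) ∈ closure (adapted V N k) := by
  induction k with
  | zero =>
    intro V _ _ _ hV X _
    exact subset_closure ⟨X, rfl, Fin.elim0, linearIndependent_empty_type, fun j => j.elim0⟩
  | succ k ih =>
    have ih := ih fun a b c hab hbc hc => hN a b c hab hbc (by omega)
    intro V _ _ _ hV X hW
    have hmonoE : Monotone fun m => (coordSubspace (outerUnion N k m k)).comap X := by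
      intro a b hab
      refine Submodule.comap_mono (coordSubspace_mono ?_)
      rintro l ⟨i, hi, hik, h⟩
      exact ⟨i, hi, hik, by omega⟩
    obtain ⟨Λ, hmono, hΛ⟩ := exists_flag _ hmonoE k fun m hm => by
      have := hW m (k + 1) (by omega) le_rfl
      refine le_trans (by omega) (this.trans (Submodule.finrank_mono
        (Submodule.comap_mono (coordSubspace_mono ?_))))
      rintro l ⟨i, hi, hik, h⟩
      exact ⟨i, hi, by omega, by omega⟩
    obtain ⟨u, hu, hu0⟩ : ∃ u ∈ (coordSubspace (N k)).comap X, u ≠ 0 := by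
      refine Submodule.exists_mem_ne_zero_of_ne_bot fun hbot => ?_
      have h1 := hW 0 k (by omega) (by omega)
      have h2 : coordSubspace (outerUnion N (k + 1) 0 k) ≤ coordSubspace (N k) := by
        refine coordSubspace_mono ?_
        rintro l ⟨i, hi, hik, h⟩
        obtain rfl : i = k := by omega
        exact hi
      have h3 := Submodule.finrank_mono (Submodule.comap_mono (f := X) h2)
      rw [hbot, finrank_bot] at h3
      omega
    have hbot : Λ 0 = ⊥ := Submodule.finrank_eq_zero.1 (hΛ 0 (by omega)).1
    refine mem_closure_adapted_of_notMem_flag hV N ?_ k 0 (by omega) X Λ hmono hΛ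
      (fun m j hmj hj => hW m j hmj (by omega)) u hu (by simpa [hbot] using hu0)
    -- What remains is the case `u ∉ Λ k`, needed for the perturbed maps and flags as well.
    clear! X Λ
    clear u hu0
    intro X Λ hmono hΛ hW u huN hu
    refine mem_closure_adapted_of_hyperplane hV N X (Λ k) (hΛ k le_rfl).1 huN hu
      (ih (Λ k) (hΛ k le_rfl).1 _ ?_)
    intro m j hmj hj
    have hcomap : ∀ T : Set ι, finrank ℂ ((coordSubspace T).comap (X.domRestrict (Λ k))) =
        finrank ℂ (Λ k ⊓ (coordSubspace T).comap X : Submodule ℂ V) := fun T => by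
      have : (coordSubspace T).comap (X.domRestrict (Λ k)) =
          ((coordSubspace T).comap X).comap (Λ k).subtype := rfl
      rw [this, ← Submodule.map_comap_subtype]
      exact (Submodule.equivSubtypeMap _ _).finrank_eq
    rw [hcomap]
    rcases hj.eq_or_lt with rfl | hj
    · have h1 : Λ m ≤ Λ j ⊓ (coordSubspace (outerUnion N j m j)).comap X :=
        le_inf (hmono hmj) (hΛ m hmj).2
      have h2 := Submodule.finrank_mono h1
      rw [(hΛ m hmj).1] at h2
      omega
    -- Intersecting with the hyperplane `Λ k` costs at most one dimension. On it the supports are in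
    -- `N 0, …, N (k - 1)`, and betweenness gives `N i ∩ N k ⊆ N (k - 1)`; as `j ≤ k - 1`, the set
    -- `N k` can be dropped from the union.
    · have h1 := Submodule.finrank_sup_add_finrank_inf_eq (Λ k)
        ((coordSubspace (outerUnion N (k + 1) m j)).comap X)
      have h2 := Submodule.finrank_le (Λ k ⊔ (coordSubspace (outerUnion N (k + 1) m j)).comap X)
      have h3 := hW m j hmj hj.le
      have h4 := (hΛ k le_rfl).1
      have h5 : Λ k ⊓ (coordSubspace (outerUnion N (k + 1) m j)).comap X ≤
          Λ k ⊓ (coordSubspace (outerUnion N k m j)).comap X := by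
        rintro v ⟨hv, hv'⟩
        refine ⟨hv, ?_⟩
        refine coordSubspace_mono ?_ (coordSubspace_inf ((hΛ k le_rfl).2 hv) hv')
        rintro l ⟨⟨i, hi, hik, -⟩, i', hi', hik', h⟩
        rcases Nat.lt_succ_iff_lt_or_eq.1 hik' with h' | rfl
        · exact ⟨i', hi', h', h⟩
        · exact ⟨i' - 1, hN i (i' - 1) i' (by omega) (by omega) (by omega) ⟨hi, hi'⟩,
            by omega, by omega⟩
      have h6 := Submodule.finrank_mono h5
      omega

/-! ### Planes with prescribed supports and checkerboard varieties. -/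

variable {n k : ℕ}

/-- The rows of the black checkers northwest of a set of red checkers. -/
def rowsNW (π : Equiv.Perm (Fin n)) (b : RedCheckers n k) (S : Set (Fin k)) : Set (Fin n) :=
  {i | ∃ j ∈ S, BlackNW π b (π.symm i) j}

/-- The matrices whose column `j` is supported in the rows of the black checkers northwest of red
checker `j`. -/
def supportCoords (π : Equiv.Perm (Fin n)) (b : RedCheckers n k) :
    Set (Matrix (Fin n) (Fin k) ℂ) :=
  {w | ∀ i j, ¬ BlackNW π b (π.symm i) j → w i j = 0}

theorem planes_subset {M M' : Matrix (Fin n) (Fin n) ℂ} {S S' : Set (Matrix (Fin n) (Fin k) ℂ)}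
    (h : ∀ Y ∈ S, (M * Y).rank = k → ∃ Y' ∈ S',
      LinearMap.range (M' * Y').mulVecLin = LinearMap.range (M * Y).mulVecLin) :
    planes M S ⊆ planes M' S' := by
  rintro _ ⟨⟨X, hX⟩, ⟨Y, hY, rfl⟩, rfl⟩
  obtain ⟨Y', hY', h'⟩ := h Y hY hX
  have hr : (M' * Y').rank = k := by
    rw [Matrix.rank, h']
    exact hX
  exact ⟨⟨M' * Y', hr⟩, ⟨Y', hY', rfl⟩, Subtype.ext h'⟩

theorem isOpen_rank_eq : IsOpen {A : Matrix (Fin n) (Fin k) ℂ | A.rank = k} := by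
  have h1 : {A : Matrix (Fin n) (Fin k) ℂ | A.rank = k} =
      (fun A : Matrix (Fin n) (Fin k) ℂ => (A.transpose : Fin k → Fin n → ℂ)) ⁻¹'
        {f | LinearIndependent ℂ f} := by
    ext A
    change A.rank = k ↔ LinearIndependent ℂ A.col
    rw [linearIndependent_iff_card_eq_finrank_span, Fintype.card_fin,
      Matrix.rank_eq_finrank_span_cols]
    exact eq_comm
  rw [h1]
  refine isOpen_setOfPred_linearIndependent.preimage ?_
  exact continuous_pi fun j => continuous_pi fun i => continuous_apply_apply i j

/-- Rank `k` is an open condition, so the approximating matrices can be taken in the Stiefel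
manifold, where `φ` is continuous. -/
theorem mem_closure_planes {M : Matrix (Fin n) (Fin n) ℂ} {S : Set (Matrix (Fin n) (Fin k) ℂ)}
    (X : Stiefel k n) (h : X.1 ∈ closure ((fun Y => M * Y) '' S)) :
    φ X ∈ closure (planes M S) := by
  have hφ : Continuous (φ : Stiefel k n → Gr k n) := continuous_coinduced_rng
  have h1 : X ∈ closure {Z : Stiefel k n | ∃ Y ∈ S, Z.1 = M * Y} := by
    rw [closure_subtype]
    have h2 := isOpen_rank_eq.inter_closure ⟨X.2, h⟩
    refine closure_mono ?_ h2
    rintro _ ⟨hr, Y, hY, rfl⟩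
    exact ⟨⟨M * Y, hr⟩, ⟨Y, hY, rfl⟩, rfl⟩
  exact map_mem_closure hφ h1 fun Z hZ => ⟨Z, hZ, rfl⟩

theorem range_mulVecLin_mul_of_isUnit {A : Matrix (Fin n) (Fin k) ℂ}
    {C : Matrix (Fin k) (Fin k) ℂ} (hC : IsUnit C.det) :
    LinearMap.range (A * C).mulVecLin = LinearMap.range A.mulVecLin := by
  rw [Matrix.mulVecLin_mul, LinearMap.range_comp_of_range_eq_top]
  rw [LinearMap.range_eq_top]
  exact Matrix.mulVec_surjective_iff_isUnit.2 ((Matrix.isUnit_iff_isUnit_det C).2 hC)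

theorem span_col_image (m : Matrix (Fin n) (Fin n) ℂ) (T : Set (Fin n)) :
    Submodule.span ℂ (m.col '' T) = (coordSubspace T).map m.mulVecLin := by
  apply le_antisymm
  · rw [Submodule.span_le]
    rintro _ ⟨i, hi, rfl⟩
    refine ⟨Pi.single i 1, fun l hl => ?_, by simp⟩
    have hli : l ≠ i := fun h => hl (h ▸ hi)
    simp [hli]
  · intro x hx
    obtain ⟨f, hf, rfl⟩ := Submodule.mem_map.1 hx
    rw [Matrix.mulVecLin_apply, Matrix.mulVec_eq_sum]
    refine Submodule.sum_mem _ fun i _ => ?_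
    by_cases hi : i ∈ T
    · rw [op_smul_eq_smul]
      exact Submodule.smul_mem _ _ (Submodule.subset_span (Set.mem_image_of_mem m.col hi))
    · rw [show f i = 0 from hf i hi]
      simp

theorem mulVecLin_injective {m : Matrix (Fin n) (Fin n) ℂ} (hm : IsUnit m.det) :
    Function.Injective m.mulVecLin :=
  Matrix.mulVec_injective_iff_isUnit.2 ((Matrix.isUnit_iff_isUnit_det m).2 hm)

theorem blackSpan_eq_map (π : Equiv.Perm (Fin n)) (b : RedCheckers n k)
    (m : Matrix (Fin n) (Fin n) ℂ) (S : Finset (Fin k)) :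
    blackSpan π b m S = (coordSubspace (rowsNW π b S)).map m.mulVecLin := by
  rw [← span_col_image, blackSpan]
  congr 1
  ext v
  constructor
  · rintro ⟨c, ⟨j, hj, h⟩, rfl⟩
    exact ⟨π c, ⟨j, hj, by simpa using h⟩, rfl⟩
  · rintro ⟨i, ⟨j, hj, h⟩, rfl⟩
    exact ⟨π.symm i, ⟨j, hj, h⟩, by simp⟩

theorem flagOf_submatrix (π : Equiv.Perm (Fin n)) (m : Matrix (Fin n) (Fin n) ℂ) (c : Fin n) :
    flagOf (m.submatrix id π) c = (coordSubspace (π '' Set.Iic c)).map m.mulVecLin := by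
  rw [← span_col_image, flagOf, Set.image_image]
  rfl

/-- In the coordinates of `m` both flags consist of coordinate subspaces, so the black checkers
northwest of one square span the intersection of two flag members. The right-hand side depends on
the flags alone, which makes the choice of the defining basis immaterial. -/
theorem blackSpan_eq_iSup (π : Equiv.Perm (Fin n)) (b : RedCheckers n k)
    {m : Matrix (Fin n) (Fin n) ℂ} (hm : IsUnit m.det) (S : Finset (Fin k)) :
    blackSpan π b m S =
      ⨆ j ∈ S, flagOf (m.submatrix id π) (b.col j) ⊓ flagOf m (b.row j) := by
  apply le_antisymm
  · rw [blackSpan, Submodule.span_le]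
    rintro _ ⟨c, ⟨j, hj, h⟩, rfl⟩
    refine Submodule.mem_iSup_of_mem j (Submodule.mem_iSup_of_mem hj ⟨?_, ?_⟩)
    · exact Submodule.subset_span ⟨c, h.1, rfl⟩
    · exact Submodule.subset_span ⟨π c, h.2, rfl⟩
  · refine iSup₂_le fun j hj => ?_
    rw [blackSpan_eq_map, flagOf_submatrix, flagOf, span_col_image,
      ← Submodule.map_inf _ (mulVecLin_injective hm)]
    refine Submodule.map_mono ?_
    rintro f ⟨h1, h2⟩
    refine coordSubspace_mono ?_ (coordSubspace_inf h1 h2)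
    rintro _ ⟨⟨c, hc, rfl⟩, hr⟩
    exact ⟨j, hj, by simpa using hc, by simpa using hr⟩

theorem DefinesPair.blackSpan_eq {π : Equiv.Perm (Fin n)} {m m' : Matrix (Fin n) (Fin n) ℂ}
    {F G : Fin n → Submodule ℂ (Fin n → ℂ)} (h : DefinesPair π m F G) (h' : DefinesPair π m' F G)
    (b : RedCheckers n k) (S : Finset (Fin k)) : blackSpan π b m S = blackSpan π b m' S := by
  rw [blackSpan_eq_iSup π b h.1, blackSpan_eq_iSup π b h'.1, ← h.2.1, ← h.2.2, ← h'.2.1,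
    ← h'.2.2]

theorem outerUnion_card (k m j : ℕ) (hmj : m ≤ j) (hj : j ≤ k) :
    m + (k - j) ≤ (Finset.univ.filter fun i : Fin k => (i : ℕ) < m ∨ j ≤ i).card := by
  have h1 : ((Finset.range m ∪ Finset.Ico j k) : Finset ℕ).card = m + (k - j) := by
    rw [Finset.card_union_of_disjoint, Finset.card_range, Nat.card_Ico]
    rw [Finset.disjoint_left]
    intro a ha ha'
    simp at ha ha'
    omega
  rw [← h1, ← Finset.card_map Fin.valEmbedding]
  refine Finset.card_le_card fun i hi => ?_
  simp only [Finset.mem_union, Finset.mem_range, Finset.mem_Ico] at hi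
  refine Finset.mem_map.2 ⟨⟨i, by omega⟩, ?_, rfl⟩
  simp only [Finset.mem_filter, Finset.mem_univ, true_and]
  omega

/-- If the row of a red checker as a function of its column first goes down and then up, the
matrices with prescribed supports parametrize a dense subset of the checkerboard variety. -/
theorem checkerboardVariety_subset_closure {π : Equiv.Perm (Fin n)} {b : RedCheckers n k}
    (hb : ∀ i j l, b.col i ≤ b.col j → b.col j ≤ b.col l → min (b.row i) (b.row l) ≤ b.row j)
    {m : Matrix (Fin n) (Fin n) ℂ} {F G : Fin n → Submodule ℂ (Fin n → ℂ)}
    (hm : DefinesPair π m F G) :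
    checkerboardVariety π b F G ⊆ closure (planes m (supportCoords π b)) := by
  rintro ⟨H, hH⟩ ⟨m', hm', hdim⟩
  replace hdim : ∀ S : Finset (Fin k),
      S.card ≤ finrank ℂ (H ⊓ blackSpan π b m S : Submodule ℂ (Fin n → ℂ)) := fun S => by
    rw [← hm'.blackSpan_eq hm]
    exact hdim S
  let e : (Fin k → ℂ) ≃ₗ[ℂ] H := LinearEquiv.ofFinrankEq _ _ (by rw [hH]; simp)
  let X : (Fin k → ℂ) →ₗ[ℂ] (Fin n → ℂ) := (m⁻¹).mulVecLin ∘ₗ H.subtype ∘ₗ e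
  have hmX : ∀ v, m.mulVec (X v) = e v := fun v => by
    simp [X, Matrix.mul_nonsing_inv _ hm.1]
  -- Red checkers are numbered by rows, but betweenness holds in the order of their columns.
  let τ : Equiv.Perm (Fin k) := Tuple.sort b.col
  have hτ : Monotone (b.col ∘ τ) := Tuple.monotone_sort b.col
  let N : ℕ → Set (Fin n) := fun i => {l | ∃ h : i < k, l ∈ rowsNW π b {τ ⟨i, h⟩}}
  have hN : ∀ a b c, a ≤ b → b ≤ c → c < k → N a ∩ N c ⊆ N b := by
    rintro i j l hij hjl hl p ⟨⟨_, _, rfl, h1⟩, _, _, rfl, h2⟩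
    refine ⟨by omega, _, rfl, ?_, ?_⟩
    · exact h1.1.trans (hτ (Fin.mk_le_mk.2 hij))
    · exact (le_min h1.2 h2.2).trans
        (hb _ _ _ (hτ (Fin.mk_le_mk.2 hij)) (hτ (Fin.mk_le_mk.2 hjl)))
  have hX : (⇑X : (Fin k → ℂ) → Fin n → ℂ) ∈ closure (adapted (Fin k → ℂ) N k) := by
    refine mem_closure_adapted N k hN _ (by simp) X fun p q hpq hq => ?_
    let S : Finset (Fin k) := (Finset.univ.filter fun i : Fin k => (i : ℕ) < p ∨ q ≤ i).map
      τ.toEmbedding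
    have h1 : p + (k - q) ≤ S.card := by
      rw [Finset.card_map]
      exact outerUnion_card k p q hpq hq
    refine (h1.trans (hdim S)).trans ?_
    rw [blackSpan_eq_map]
    set W := (coordSubspace (rowsNW π b S)).map m.mulVecLin
    have h2 : ((W.comap H.subtype).comap (e : (Fin k → ℂ) →ₗ[ℂ] H)) ≤
        (coordSubspace (outerUnion N k p q)).comap X := by
      rintro v ⟨f, hf, hfv⟩
      have hfX : f = X v := mulVecLin_injective hm.1 (by
        rw [hfv, Matrix.mulVecLin_apply, hmX]
        rfl)
      rw [Submodule.mem_comap, ← hfX]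
      refine coordSubspace_mono ?_ hf
      rintro l ⟨j, hj, hl⟩
      obtain ⟨i, hi, rfl⟩ := Finset.mem_map.1 hj
      exact ⟨i, ⟨i.2, _, rfl, hl⟩, i.2, (Finset.mem_filter.1 hi).2⟩
    refine le_trans (le_of_eq ?_) (Submodule.finrank_mono h2)
    have h3 : ((W.comap H.subtype).comap (e : (Fin k → ℂ) →ₗ[ℂ] H)) =
        (W.comap H.subtype).map (e.symm : H →ₗ[ℂ] (Fin k → ℂ)) :=
      (Submodule.map_equiv_eq_comap_symm e.symm (W.comap H.subtype)).symm
    rw [h3, LinearEquiv.finrank_map_eq, ← Submodule.map_comap_subtype]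
    exact (Submodule.equivSubtypeMap _ _).finrank_eq.symm
  let Ψ : ((Fin k → ℂ) → Fin n → ℂ) → Matrix (Fin n) (Fin k) ℂ :=
    fun f => m * Matrix.of fun i j => f (Pi.single j 1) i
  have hΨ : Continuous Ψ := by
    refine Continuous.matrix_mul continuous_const ?_
    exact continuous_matrix fun i j => (continuous_apply i).comp (continuous_apply (Pi.single j 1))
  have hmat : ∀ (Y : (Fin k → ℂ) →ₗ[ℂ] (Fin n → ℂ)) (v : Fin k → ℂ),
      (Matrix.of fun i j => Y (Pi.single j 1) i).mulVec v = Y v := fun Y v => by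
    have : (Matrix.of fun i j => Y (Pi.single j 1) i) = LinearMap.toMatrix' Y := by
      ext i j
      simp [LinearMap.toMatrix'_apply]
    rw [this, LinearMap.toMatrix'_mulVec]
  have hrange : LinearMap.range (Ψ X).mulVecLin = H := by
    ext x
    simp only [LinearMap.mem_range, Matrix.mulVecLin_apply, Ψ, ← Matrix.mulVec_mulVec, hmat, hmX]
    constructor
    · rintro ⟨v, rfl⟩
      exact (e v).2
    · intro hx
      exact ⟨e.symm ⟨x, hx⟩, by simp⟩
  have hrank : (Ψ X).rank = k := by
    rw [Matrix.rank, hrange, hH]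
  have hφ : φ ⟨Ψ X, hrank⟩ = (⟨H, hH⟩ : Gr k n) := Subtype.ext hrange
  -- The bases adapted to the approximating maps need not converge, so the support is prescribed
  -- only up to a change of basis `C`.
  have hcl : Ψ X ∈ closure ((fun Y => m * Y) '' {Y : Matrix (Fin n) (Fin k) ℂ |
      ∃ C : Matrix (Fin k) (Fin k) ℂ, IsUnit C.det ∧ Y * C ∈ supportCoords π b}) := map_mem_closure hΨ hX ?_
  rw [← hφ]
  refine closure_mono (planes_subset (S := {Y | ∃ C : Matrix (Fin k) (Fin k) ℂ, IsUnit C.det ∧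
    Y * C ∈ supportCoords π b}) ?_) (mem_closure_planes ⟨Ψ X, hrank⟩ hcl)
  · rintro Y ⟨C, hC, hYC⟩ -
    exact ⟨_, hYC, by rw [← Matrix.mul_assoc, range_mulVecLin_mul_of_isUnit hC]⟩
  · rintro f ⟨Y, rfl, v, hv, hvN⟩
    refine ⟨_, ⟨Matrix.of fun i j => v (τ.symm j) i, ?_, ?_⟩, rfl⟩
    · rw [← Matrix.isUnit_iff_isUnit_det, ← Matrix.linearIndependent_cols_iff_isUnit]
      exact hv.comp _ τ.symm.injective
    · intro i j hij
      have h1 := hvN (τ.symm j) i (by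
        rintro ⟨_, _, rfl, h⟩
        exact hij (by simpa using h))
      rw [← hmat] at h1
      exact h1

/-- Prescribed coordinates of matrices with prescribed supports are generically nonzero. -/
theorem planes_supportCoords_subset_closure {π : Equiv.Perm (Fin n)} {b : RedCheckers n k}
    (m : Matrix (Fin n) (Fin n) ℂ) (J : Set (Fin n × Fin k))
    (hJ : ∀ p ∈ J, BlackNW π b (π.symm p.1) p.2) :
    planes m (supportCoords π b) ⊆
      closure (planes m {w ∈ supportCoords π b | ∀ p ∈ J, w p.1 p.2 ≠ 0}) := by
  classical
  rintro _ ⟨X, ⟨w, hw, hX⟩, rfl⟩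
  refine mem_closure_planes X ?_
  rw [hX]
  refine map_mem_closure (continuous_const.matrix_mul continuous_id) (s := {w ∈ supportCoords π b |
    ∀ p ∈ J, w p.1 p.2 ≠ 0}) ?_ fun Y hY => ⟨Y, hY, rfl⟩
  let w0 : Matrix (Fin n) (Fin k) ℂ := Matrix.of fun i j => if (i, j) ∈ J then 1 else 0
  have hw0 : ∀ i j, w0 i j = if (i, j) ∈ J then 1 else 0 := fun i j => rfl
  have hc : Continuous fun ε : ℂ => w + ε • w0 := by fun_prop
  have hlim : Tendsto (fun ε : ℂ => w + ε • w0) (𝓝[≠] 0) (𝓝 w) := by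
    have := (hc.tendsto 0).mono_left (nhdsWithin_le_nhds (s := {0}ᶜ))
    simpa using this
  refine mem_closure_of_tendsto hlim ?_
  have h1 : ∀ᶠ ε : ℂ in 𝓝[≠] 0, ∀ p : Fin n × Fin k, p ∈ J → w p.1 p.2 + ε ≠ 0 := by
    rw [eventually_all]
    intro p
    rcases eq_or_ne (w p.1 p.2) 0 with h | h
    · filter_upwards [self_mem_nhdsWithin] with ε hε _
      simpa [h] using hε
    · have hc' : Continuous fun ε : ℂ => w p.1 p.2 + ε := by fun_prop
      have := hc'.continuousAt.eventually_ne (x := (0 : ℂ)) (y := 0) (by simpa using h)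
      filter_upwards [this.filter_mono nhdsWithin_le_nhds] with ε hε _ using hε
  filter_upwards [h1] with ε hε
  refine ⟨fun i j hij => ?_, fun p hp => ?_⟩
  · have : (i, j) ∉ J := fun h => hij (hJ _ h)
    simp [hw0, this, hw i j hij]
  · have := hε p hp
    simpa [hw0, hp] using this

/-! ### The permutation arrays of the bubble sort. -/

namespace MidSort

variable {σ : Equiv.Perm (Fin n)} {d r r' : Fin n}

theorem lt_next (h : MidSort σ d r r') : r < r' := by
  have := h.next
  rw [Fin.lt_def]
  omega

/-- Otherwise column `n - 1 - r`, counted from `0`, would be to the right of `d`; its antidiagonal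
checker is in row `r`, which the checker of column `d` occupies. -/
theorem regionA_lt (h : MidSort σ d r r') {c : Fin n} (hc : d < c) : σ c < r := by
  rw [Fin.lt_def]
  by_contra! hlt
  have hn := c.2
  have h1 := h.regionA c hc
  have h2 : (n - 1 - r : ℕ) < n := by omega
  have h3 := h.regionA ⟨n - 1 - r, h2⟩ (by
    rw [Fin.lt_def] at hc ⊢
    change (d : ℕ) < n - 1 - r
    omega)
  have h4 : σ ⟨n - 1 - r, h2⟩ = r := by
    rw [Fin.ext_iff]
    simp only at h3
    omega
  have h5 := σ.injective (h4.trans h.descending.symm)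
  rw [← h5, Fin.lt_def] at hc
  simp only at hc
  omega

theorem symm_next_lt (h : MidSort σ d r r') : σ.symm r' < d := by
  rcases lt_trichotomy (σ.symm r') d with h1 | h1 | h1
  · exact h1
  · have h2 : σ (σ.symm r') = r := h1 ▸ h.descending
    rw [Equiv.apply_symm_apply] at h2
    exact absurd h2 h.lt_next.ne'
  · have h2 := h.regionA_lt h1
    rw [Equiv.apply_symm_apply] at h2
    exact absurd h2 h.lt_next.not_gt

theorem next_le {i : Fin n} (h : MidSort σ d r r') (hi : r < i) : r' ≤ i := by
  have := h.next
  rw [Fin.lt_def] at hi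
  rw [Fin.le_def]
  omega

theorem nextPerm_of_ne {c : Fin n} (h1 : σ c ≠ r) (h2 : σ c ≠ r') : nextPerm σ r r' c = σ c :=
  Equiv.swap_apply_of_ne_of_ne h1 h2

theorem nextPerm_descending (h : MidSort σ d r r') : nextPerm σ r r' d = r' := by
  change Equiv.swap r r' (σ d) = r'
  rw [h.descending, Equiv.swap_apply_left]

theorem nextPerm_ascending : nextPerm σ r r' (σ.symm r') = r := by
  change Equiv.swap r r' (σ (σ.symm r')) = r
  rw [Equiv.apply_symm_apply, Equiv.swap_apply_right]

theorem nextPerm_of_lt (h : MidSort σ d r r') {c : Fin n} (hc : c < d) (h1 : c ≠ σ.symm r') :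
    nextPerm σ r r' c = σ c :=
  nextPerm_of_ne (fun h' => hc.ne (σ.injective (h'.trans h.descending.symm)))
    fun h' => h1 (by rw [← h', Equiv.symm_apply_apply])

theorem nextPerm_of_gt (h : MidSort σ d r r') {c : Fin n} (hc : d < c) :
    nextPerm σ r r' c = σ c :=
  nextPerm_of_ne (h.regionA_lt hc).ne ((h.regionA_lt hc).trans h.lt_next).ne

end MidSort

/-! ### The bitonic shape of the game nodes. -/

/-- The form of the nodes of checkerboard games: on an array that is sorted to the left of column
`d` and antidiagonal to the right of it, the red checkers to the left of column `d` are in squares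
of black checkers, and the others go up from left to right. -/
structure IsSortedNode (σ : Equiv.Perm (Fin n)) (b : RedCheckers n k) (d : Fin n) : Prop where
  regionA : ∀ c, d < c → (σ c : ℕ) + c + 1 = n
  regionBE : StrictMonoOn σ (Set.Iio d)
  on_black : ∀ j, b.col j < d → σ (b.col j) = b.row j
  antichain : ∀ i j, d ≤ b.col i → b.col i < b.col j → b.row j < b.row i
  below : ∀ j, d ≤ b.col j → n ≤ (b.row j : ℕ) + b.col j + 1
  descending : ∀ j, b.col j = d → σ d ≤ b.row j

namespace IsSortedNode

variable {σ : Equiv.Perm (Fin n)} {d r r' : Fin n} {b : RedCheckers n k}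

/-- The descending column either stays the same or moves on by one, after its checker has reached
the bottom row. In the latter case a red checker in column `d₀` is not above the black checker
there, so it shares its square. -/
theorem of_midSort {d₀ : Fin n} (h : IsSortedNode σ b d₀) (hσ : MidSort σ d r r') :
    IsSortedNode σ b d := by
  have hn : n - 1 < n := by have := d.2; omega
  rcases lt_trichotomy d d₀ with hlt | rfl | hlt
  · have h1 := h.regionBE (hσ.symm_next_lt.trans hlt) hlt hσ.symm_next_lt
    rw [Equiv.apply_symm_apply, hσ.descending] at h1
    exact absurd h1 hσ.lt_next.not_gt
  · exact h
  · have hmax : σ d₀ = ⟨n - 1, hn⟩ := by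
      obtain ⟨c, hc⟩ := σ.surjective ⟨n - 1, hn⟩
      rcases lt_trichotomy c d₀ with h1 | rfl | h1
      · have h2 := hσ.regionBE (h1.trans hlt) hlt h1
        rw [hc, Fin.lt_def] at h2
        have := (σ d₀).2
        simp only at h2
        omega
      · exact hc
      · have h2 := h.regionA c h1
        rw [hc] at h2
        rw [Fin.lt_def] at h1
        simp only at h2
        omega
    have hd : (d : ℕ) = d₀ + 1 := by
      by_contra hne
      rw [Fin.lt_def] at hlt
      have h1 : (d₀ + 1 : ℕ) < n := by omega
      have h2 := @hσ.regionBE d₀ (Fin.lt_def.2 hlt) ⟨d₀ + 1, h1⟩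
        (Fin.lt_def.2 (by simp only; omega)) (Fin.lt_def.2 (by simp))
      rw [hmax, Fin.lt_def] at h2
      have := (σ ⟨d₀ + 1, h1⟩).2
      simp only at h2
      omega
    have hle : ∀ {c : Fin n}, d ≤ c → d₀ < c := fun hc => hlt.trans_le hc
    refine ⟨hσ.regionA, hσ.regionBE, fun j hj => ?_,
      fun i j hi hij => h.antichain i j (hle hi).le hij, fun j hj => h.below j (hle hj).le,
      fun j hj => ?_⟩
    · have hj' : b.col j ≤ d₀ := by
        rw [Fin.lt_def] at hj
        rw [Fin.le_def]
        omega
      rcases hj'.lt_or_eq with h1 | h1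
      · exact h.on_black j h1
      · have h2 := h.descending j h1
        rw [h1]
        refine le_antisymm h2 ?_
        rw [hmax, Fin.le_def]
        have := (b.row j).2
        simp only
        omega
    · have h1 := h.regionA d hlt
      have h2 := h.below j (hj ▸ hlt.le)
      rw [hj] at h2
      rw [Fin.le_def]
      omega

/-- The middle checker is compared with the left one if it is left of `d`, and with the right one
otherwise. This is the source of the betweenness property. -/
theorem unimodal (h : IsSortedNode σ b d) (i j l : Fin k) (hij : b.col i ≤ b.col j)
    (hjl : b.col j ≤ b.col l) : min (b.row i) (b.row l) ≤ b.row j := by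
  rcases hij.eq_or_lt with h1 | hij
  · exact (min_le_left _ _).trans (b.col_injective h1 ▸ le_rfl)
  rcases hjl.eq_or_lt with h1 | hjl
  · exact (min_le_right _ _).trans (b.col_injective h1 ▸ le_rfl)
  rcases lt_or_ge (b.col j) d with hj | hj
  · refine (min_le_left _ _).trans ?_
    rw [← h.on_black j hj, ← h.on_black i (hij.trans hj)]
    exact (h.regionBE (hij.trans hj) hj hij).le
  · exact (min_le_right _ _).trans (h.antichain j l hj hjl).le

/-- Left of `d` the red checker sits on this black checker. From `d` on it is on or below the
antidiagonal, while the black checker of its row is on the antidiagonal or in a column up to `d`. -/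
theorem blackNW_pivot (h : IsSortedNode σ b d) (j : Fin k) :
    BlackNW σ b (σ.symm (b.row j)) j := by
  refine ⟨?_, by simp⟩
  rcases lt_or_ge (b.col j) d with hj | hj
  · rw [← h.on_black j hj, Equiv.symm_apply_apply]
  · rcases lt_or_ge d (σ.symm (b.row j)) with h1 | h1
    · have h2 := h.regionA _ h1
      rw [Equiv.apply_symm_apply] at h2
      have h3 := h.below j hj
      rw [Fin.le_def]
      omega
    · exact h1.trans hj

/-- The red checker in the critical row is in column `d` or to the right of it. -/
theorem le_col_of_row_eq (h : IsSortedNode σ b d) (hσ : MidSort σ d r r') {s : Fin k}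
    (hs : b.row s = r) : d ≤ b.col s := by
  by_contra! hlt
  have h1 := h.on_black s hlt
  rw [hs, ← hσ.descending] at h1
  exact hlt.ne (σ.injective h1)

/-- A red checker strictly between the two rows would be in a column `≥ d` by the choice of `s'`,
and left of `s` by the antichain condition: a blocker. In the two situations where blockers are not
excluded by the rules, there is no column or no row left for one. -/
theorem row_notMem_gap (h : IsSortedNode σ b d) (hσ : MidSort σ d r r') {s s' : Fin k}
    {child : RedCheckers n k} (hm : SwapMove σ d r r' s s' b child) {j : Fin k}
    (hj : r < b.row j) : b.row s' ≤ b.row j := by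
  by_contra! hlt
  have hd := h.le_col_of_row_eq hσ hm.critical
  obtain ⟨⟨hs'd, hs'r, hs'σ⟩, htop⟩ := hm.top
  have hjd : d ≤ b.col j := by
    by_contra! hjd
    exact hlt.not_ge (htop j ⟨hjd, hj, h.on_black j hjd⟩)
  have hjs : b.col j < b.col s := by
    rcases lt_trichotomy (b.col j) (b.col s) with h1 | h1 | h1
    · exact h1
    · rw [b.col_injective h1, hm.critical] at hj
      exact absurd hj (lt_irrefl _)
    · have h2 := h.antichain s j hd h1
      rw [hm.critical] at h2
      exact absurd h2 hj.not_gt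
  refine hm.no_blocker ?_ ?_ j ⟨by rwa [hm.critical], hlt, hs'd.trans_le hjd, hjs⟩
  · intro h1
    exact (hjd.trans_lt (h1 ▸ hjs)).ne rfl
  · intro h1
    rw [h1, Equiv.apply_symm_apply] at hs'σ
    rw [← hs'σ] at hlt
    exact hlt.not_ge (hσ.next_le hj)

theorem nextPerm_regionA (hσ : MidSort σ d r r') (c : Fin n) (hc : d < c) :
    (nextPerm σ r r' c : ℕ) + c + 1 = n := by
  rw [hσ.nextPerm_of_gt hc]
  exact hσ.regionA c hc

theorem nextPerm_regionBE (hσ : MidSort σ d r r') :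
    StrictMonoOn (nextPerm σ r r') (Set.Iio d) := by
  intro a ha c hc hac
  have h1 := hσ.regionBE ha hc hac
  by_cases ha' : a = σ.symm r'
  · have hc' : c ≠ σ.symm r' := fun h => hac.ne (ha'.trans h.symm)
    rw [hσ.nextPerm_of_lt hc hc']
    subst ha'
    rw [MidSort.nextPerm_ascending]
    rw [Equiv.apply_symm_apply] at h1
    exact hσ.lt_next.trans h1
  · rw [hσ.nextPerm_of_lt ha ha']
    by_cases hc' : c = σ.symm r'
    · subst hc'
      rw [MidSort.nextPerm_ascending]
      rw [Equiv.apply_symm_apply] at h1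
      have h2 : σ a ≠ r := fun h => (Set.mem_Iio.1 ha).ne
        (σ.injective (h.trans hσ.descending.symm))
      have h3 := hσ.next
      rw [Fin.lt_def] at h1 ⊢
      rw [Ne, Fin.ext_iff] at h2
      omega
    · rwa [hσ.nextPerm_of_lt hc hc']

end IsSortedNode

namespace SwapMove

variable {σ : Equiv.Perm (Fin n)} {d r r' : Fin n} {s s' : Fin k} {b child : RedCheckers n k}

theorem ne (hm : SwapMove σ d r r' s s' b child) : s ≠ s' := fun h => by
  have := hm.top.1.2.1
  rw [← h, hm.critical] at this
  exact lt_irrefl _ this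

theorem col_s (hm : SwapMove σ d r r' s s' b child) : child.col s = σ.symm r' := by
  rw [hm.col_eq, Function.update_of_ne hm.ne, Function.update_self]

theorem col_s' (hm : SwapMove σ d r r' s s' b child) : child.col s' = b.col s := by
  rw [hm.col_eq, Function.update_self]

theorem col_of_ne (hm : SwapMove σ d r r' s s' b child) {j : Fin k} (hs : j ≠ s) (hs' : j ≠ s') :
    child.col j = b.col j := by
  rw [hm.col_eq, Function.update_of_ne hs', Function.update_of_ne hs]

/-- `s` lands on the ascending black checker and `s'` replaces `s` in the antichain. The order there
survives because no red checker is in a row strictly between theirs. -/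
theorem isSortedNode (hm : SwapMove σ d r r' s s' b child) (h : IsSortedNode σ b d)
    (hσ : MidSort σ d r r') : IsSortedNode (nextPerm σ r r') child d := by
  have hd := h.le_col_of_row_eq hσ hm.critical
  obtain ⟨⟨hs'd, hs'r, hs'σ⟩, htop⟩ := hm.top
  have he := hσ.symm_next_lt
  have hother : ∀ {j}, j ≠ s → j ≠ s' → child.col j = b.col j := fun h1 h2 => hm.col_of_ne h1 h2
  have hnot : ∀ {j}, d ≤ child.col j → j ≠ s := by
    rintro j hj rfl
    rw [hm.col_s] at hj
    exact he.not_ge hj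
  refine ⟨IsSortedNode.nextPerm_regionA hσ, IsSortedNode.nextPerm_regionBE hσ, fun j hj => ?_,
    fun i j hi hij => ?_, fun j hj => ?_, fun j hj => ?_⟩
  · rw [hm.row_eq]
    by_cases hjs : j = s
    · rw [hjs, hm.col_s, MidSort.nextPerm_ascending, hm.critical]
    by_cases hjs' : j = s'
    · rw [hjs', hm.col_s'] at hj
      exact absurd hd hj.not_ge
    rw [hother hjs hjs'] at hj ⊢
    rw [hσ.nextPerm_of_lt hj, h.on_black j hj]
    intro he'
    have h1 := h.on_black j hj
    rw [he', Equiv.apply_symm_apply] at h1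
    have h2 := htop j ⟨hj, h1 ▸ hσ.lt_next, h.on_black j hj⟩
    exact hjs' (b.row_strictMono.injective (le_antisymm (h1 ▸ hσ.next_le hs'r) h2))
  · rw [hm.row_eq]
    have his := hnot hi
    have hjs := hnot (hi.trans hij.le)
    by_cases his' : i = s'
    · have hjs' : j ≠ s' := by
        rintro rfl
        exact hij.ne (by rw [his'])
      rw [his', hm.col_s', hother hjs hjs'] at hij
      rw [his']
      exact (hm.critical ▸ h.antichain s j hd hij).trans hs'r
    rw [hother his his'] at hi hij
    by_cases hjs' : j = s'
    · rw [hjs', hm.col_s'] at hij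
      rw [hjs']
      have h1 := h.antichain i s hi hij
      rw [hm.critical] at h1
      refine lt_of_le_of_ne (h.row_notMem_gap hσ hm h1) fun h2 => his' ?_
      exact (b.row_strictMono.injective h2).symm
    rw [hother hjs hjs'] at hij
    exact h.antichain i j hi hij
  · rw [hm.row_eq]
    have hjs := hnot hj
    by_cases hjs' : j = s'
    · rw [hjs', hm.col_s']
      have h1 := h.below s hd
      rw [hm.critical] at h1
      rw [Fin.lt_def] at hs'r
      omega
    rw [hother hjs hjs'] at hj ⊢
    exact h.below j hj
  · rw [hm.row_eq, hσ.nextPerm_descending]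
    have hjs := hnot hj.ge
    by_cases hjs' : j = s'
    · rw [hjs']
      exact hσ.next_le hs'r
    rw [hother hjs hjs'] at hj
    have h1 := h.descending j hj
    rw [hσ.descending] at h1
    refine hσ.next_le (lt_of_le_of_ne h1 fun h2 => hjs ?_)
    exact b.row_strictMono.injective (h2.symm.trans hm.critical.symm)

end SwapMove

theorem IsSortedNode.of_stay {σ : Equiv.Perm (Fin n)} {d r r' : Fin n} {b : RedCheckers n k}
    (h : IsSortedNode σ b d) (hσ : MidSort σ d r r') (h1 : ∀ j, b.col j ≠ σ.symm r')
    (h2 : ∀ j, b.col j = d → b.row j ≠ r) : IsSortedNode (nextPerm σ r r') b d := by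
  refine ⟨nextPerm_regionA hσ, nextPerm_regionBE hσ, fun j hj => ?_, h.antichain, h.below,
    fun j hj => ?_⟩
  · rw [hσ.nextPerm_of_lt hj (h1 j), h.on_black j hj]
  · have h3 := h.descending j hj
    rw [hσ.descending] at h3
    rw [hσ.nextPerm_descending]
    exact hσ.next_le (lt_of_le_of_ne h3 (h2 j hj).symm)

theorem OtherMove.isSortedNode {σ : Equiv.Perm (Fin n)} {d r r' : Fin n}
    {b child : RedCheckers n k} (hm : OtherMove σ d r r' b child) (h : IsSortedNode σ b d)
    (hσ : MidSort σ d r r') : IsSortedNode (nextPerm σ r r') child d := by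
  have he := hσ.symm_next_lt
  have hrow : ∀ {j}, b.col j = σ.symm r' → b.row j = r' := fun {j} hj => by
    rw [← h.on_black j (hj ▸ he), hj, Equiv.apply_symm_apply]
  have hcrit : ∀ {j}, b.col j = σ.symm r' → OnCriticalDiagonal σ d r b j := fun {j} hj =>
    ⟨hj ▸ he, hrow hj ▸ hσ.lt_next, h.on_black j (hj ▸ he)⟩
  cases hm with
  | ascend _ j hr hj hjc hrow' hcol =>
    have hother : ∀ {l}, l ≠ j → child.row l = b.row l := fun hl => by
      rw [hrow', Function.update_of_ne hl]
    have hnot : ∀ {l}, d ≤ b.col l → l ≠ j := by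
      rintro l hl rfl
      exact he.not_ge (hjc ▸ hl)
    refine ⟨IsSortedNode.nextPerm_regionA hσ, IsSortedNode.nextPerm_regionBE hσ, ?_, ?_, ?_, ?_⟩
    all_goals simp only [hcol]
    · intro l hl
      by_cases hlj : l = j
      · rw [hlj, hjc, MidSort.nextPerm_ascending, hrow', Function.update_self]
      · rw [hother hlj, hσ.nextPerm_of_lt hl, h.on_black l hl]
        exact fun h1 => hlj (b.col_injective (h1.trans hjc.symm))
    · intro i l hi hil
      rw [hother (hnot hi), hother (hnot (hi.trans hil.le))]
      exact h.antichain i l hi hil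
    · intro l hl
      rw [hother (hnot hl)]
      exact h.below l hl
    · intro l hl
      have h1 := h.descending l hl
      rw [hσ.descending] at h1
      rw [hother (hnot hl.ge), hσ.nextPerm_descending]
      exact hσ.next_le (lt_of_le_of_ne h1 (hr l).symm)
  | stayEmptyRow hr hj =>
    exact h.of_stay hσ (fun j hjc => hj j ⟨hrow hjc, hjc⟩) fun j _ => hr j
  | left _ s hs hsd hl hrow' hcol =>
    have hother : ∀ {l}, l ≠ s → child.col l = b.col l := fun hl => by
      rw [hcol, Function.update_of_ne hl]
    have hcs : child.col s = σ.symm r' := by rw [hcol, Function.update_self]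
    have hnot : ∀ {l}, d ≤ child.col l → l ≠ s := by
      rintro l hl rfl
      exact he.not_ge (hcs ▸ hl)
    refine ⟨IsSortedNode.nextPerm_regionA hσ, IsSortedNode.nextPerm_regionBE hσ, ?_, ?_, ?_, ?_⟩
    all_goals simp only [hrow']
    · intro l hl'
      by_cases hls : l = s
      · rw [hls, hcs, MidSort.nextPerm_ascending, hs]
      · rw [hother hls] at hl' ⊢
        rw [hσ.nextPerm_of_lt hl', h.on_black l hl']
        exact fun h1 => hl l (hcrit h1)
    · intro i l hi hil
      have h1 := hnot hi
      have h2 := hnot (hi.trans hil.le)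
      rw [hother h1] at hi hil
      rw [hother h2] at hil
      exact h.antichain i l hi hil
    · intro l hl'
      have h1 := hnot hl'
      rw [hother h1] at hl' ⊢
      exact h.below l hl'
    · intro l hl'
      have h1 := hnot hl'.ge
      rw [hother h1] at hl'
      exact absurd (b.col_injective (hl'.trans hsd.symm)) h1
  | stayEmptyDiagonal s hs hsd hl =>
    exact h.of_stay hσ (fun j hj => hl j (hcrit hj)) fun j hj hjr =>
      hsd (b.row_strictMono.injective (hjr.trans hs.symm) ▸ hj)
  | stay s j hs hsd hj hjc =>
    refine h.of_stay hσ (fun l hl => hjc ?_) fun j hj hjr =>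
      hsd (b.row_strictMono.injective (hjr.trans hs.symm) ▸ hj)
    have h1 := hj.2 l (hcrit hl)
    rw [hrow hl] at h1
    have h2 := le_antisymm h1 (hσ.next_le hj.1.2.1)
    rw [← h2, ← hj.1.2.2, Equiv.symm_apply_apply]

/-- At the root `d` is the first column, so the sorted part is empty; the checkerboard condition for
single red checkers puts them on or below the antidiagonal. Every move preserves the shape. -/
theorem GameNode.exists_isSortedNode (hn : 0 < n) {σ : Equiv.Perm (Fin n)} {b : RedCheckers n k}
    (h : GameNode σ b) : ∃ d, IsSortedNode σ b d := by
  induction h with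
  | root α β hα hβ b hb hcb =>
    have hcol : ∀ j, b.col j = α (Fin.rev j) := fun j => by
      have := (hb (Fin.rev j)).2
      rwa [Fin.rev_rev] at this
    have hbelow : ∀ j, n ≤ (b.row j : ℕ) + b.col j + 1 := by
      intro j
      have h1 := hcb {j}
      rw [Finset.card_singleton] at h1
      obtain ⟨c, i, hi, hc1, hc2⟩ := Set.nonempty_of_ncard_ne_zero (Nat.one_le_iff_ne_zero.1 h1)
      rw [Finset.mem_singleton] at hi
      subst hi
      rw [Fin.le_def] at hc1 hc2
      rw [Fin.revPerm_apply, Fin.val_rev] at hc2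
      omega
    refine ⟨⟨0, hn⟩, fun c _ => ?_, ?_, ?_, ?_, fun j _ => hbelow j, fun j hj => ?_⟩
    · rw [Fin.revPerm_apply, Fin.val_rev]
      omega
    · intro a ha
      exact absurd (Fin.lt_def.1 (Set.mem_Iio.1 ha)) (Nat.not_lt_zero _)
    · intro j hj
      exact absurd (Fin.lt_def.1 hj) (Nat.not_lt_zero _)
    · intro i j _ hij
      rw [hcol, hcol] at hij
      exact b.row_strictMono (Fin.rev_lt_rev.1 (hα.lt_iff_lt.1 hij))
    · have h1 := hbelow j
      rw [hj] at h1
      rw [Fin.revPerm_apply, Fin.le_def, Fin.val_rev]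
      simp only at h1 ⊢
      omega
  | swap σ d r r' s s' parent child _ hσ hm ih =>
    obtain ⟨d₀, h0⟩ := ih
    exact ⟨d, hm.isSortedNode (h0.of_midSort hσ) hσ⟩
  | other σ d r r' parent child _ hσ hm ih =>
    obtain ⟨d₀, h0⟩ := ih
    exact ⟨d, hm.isSortedNode (h0.of_midSort hσ) hσ⟩

/-! ### Pivots and reduction to echelon form. -/

theorem supportCoords_eq_zero {π : Equiv.Perm (Fin n)} {b : RedCheckers n k}
    {w : Matrix (Fin n) (Fin k) ℂ} (hw : w ∈ supportCoords π b) {i : Fin n} {j : Fin k}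
    (h : b.col j < π.symm i ∨ b.row j < i) : w i j = 0 := by
  refine hw i j fun h' => ?_
  have h2 := h'.2
  rw [Equiv.apply_symm_apply] at h2
  exact h.elim h'.1.not_gt h2.not_gt

theorem rank_eq_of_pivots {z : Matrix (Fin n) (Fin k) ℂ} (f : Fin k → Fin n)
    (h0 : ∀ i j, j < i → z (f i) j = 0) (h1 : ∀ j, z (f j) j ≠ 0) : z.rank = k := by
  have hdet : IsUnit (z.submatrix f id).det := by
    have ht : (z.submatrix f id).IsUpperTriangular := fun i j hij => h0 i j hij
    rw [Matrix.det_of_isUpperTriangular ht, isUnit_iff_ne_zero]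
    exact Finset.prod_ne_zero_iff.2 fun j _ => h1 j
  have hinj : Function.Injective z.mulVecLin := by
    rw [← LinearMap.ker_eq_bot, LinearMap.ker_eq_bot']
    intro v hv
    have h2 : (z.submatrix f id).mulVec v = 0 := by
      funext i
      exact congrFun hv (f i)
    have h3 := Matrix.mulVec_injective_iff_isUnit.2
      ((Matrix.isUnit_iff_isUnit_det (z.submatrix f id)).2 hdet)
    exact h3 (h2.trans (Matrix.mulVec_zero _).symm)
  rw [Matrix.rank, LinearMap.finrank_range_of_inj hinj]
  simp

theorem rank_eq_of_mem_supportCoords {π : Equiv.Perm (Fin n)} {b : RedCheckers n k}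
    {w : Matrix (Fin n) (Fin k) ℂ} (hw : w ∈ supportCoords π b)
    (h1 : ∀ j, w (b.row j) j ≠ 0) : w.rank = k :=
  rank_eq_of_pivots b.row
    (fun _ _ hij => supportCoords_eq_zero hw (Or.inr (b.row_strictMono hij))) h1

theorem col_mem_range (A : Matrix (Fin n) (Fin k) ℂ) (j : Fin k) :
    A.col j ∈ LinearMap.range A.mulVecLin :=
  ⟨Pi.single j 1, by simp⟩

theorem range_le_of_col_mem {A : Matrix (Fin n) (Fin k) ℂ} {P : Submodule ℂ (Fin n → ℂ)}
    (h : ∀ j, A.col j ∈ P) : LinearMap.range A.mulVecLin ≤ P := by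
  rw [Matrix.range_mulVecLin, Submodule.span_le]
  rintro _ ⟨j, rfl⟩
  exact h j

theorem range_eq_of_col_mem {A B : Matrix (Fin n) (Fin k) ℂ} (hA : A.rank = k)
    (h : ∀ j, A.col j ∈ LinearMap.range B.mulVecLin) :
    LinearMap.range A.mulVecLin = LinearMap.range B.mulVecLin := by
  refine Submodule.eq_of_le_of_finrank_le (range_le_of_col_mem h) ?_
  have h1 := B.rank_le_width
  rw [Matrix.rank] at h1 hA
  omega

theorem range_mul_congr {A B : Matrix (Fin n) (Fin k) ℂ} (M : Matrix (Fin n) (Fin n) ℂ)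
    (h : LinearMap.range A.mulVecLin = LinearMap.range B.mulVecLin) :
    LinearMap.range (M * A).mulVecLin = LinearMap.range (M * B).mulVecLin := by
  rw [Matrix.mulVecLin_mul, Matrix.mulVecLin_mul, LinearMap.range_comp, LinearMap.range_comp, h]

/-- One column of the reduction to echelon form. -/
theorem exists_reduced_col {π : Equiv.Perm (Fin n)} {b : RedCheckers n k}
    {w : Matrix (Fin n) (Fin k) ℂ} (hw : w ∈ supportCoords π b)
    (hpiv : ∀ l, w (b.row l) l ≠ 0) (j : Fin k) (p q : ℕ) (hpq : q + p = j) :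
    ∃ v : Fin n → ℂ, v ∈ LinearMap.range w.mulVecLin ∧
      (∀ i, ¬ BlackNW π b (π.symm i) j → v i = 0) ∧
      (∀ i, (∀ l < j, b.row l < i) → v i = w i j) ∧
      ∀ l < j, q ≤ (l : ℕ) → π (b.col l) = b.row l → v (b.row l) = 0 := by
  induction p generalizing q with
  | zero =>
    exact ⟨w.col j, col_mem_range w j, fun i hi => hw i j hi, fun _ _ => rfl,
      fun l hl hq => by rw [Fin.lt_def] at hl; omega⟩
  | succ p ih =>
    obtain ⟨v, hv, hsupp, htop, hred⟩ := ih (q + 1) (by omega)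
    have hq : q < k := by have := j.2; omega
    by_cases hz : π (b.col ⟨q, hq⟩) = b.row ⟨q, hq⟩ ∧ v (b.row ⟨q, hq⟩) ≠ 0
    · obtain ⟨hblack, hne⟩ := hz
      set a : Fin k := ⟨q, hq⟩
      have haj : a < j := by
        rw [Fin.lt_def]
        change q < j
        omega
      have hsymm : π.symm (b.row a) = b.col a := by rw [← hblack, Equiv.symm_apply_apply]
      have hNW : BlackNW π b (b.col a) j := by
        by_contra h
        exact hne (hsupp _ (by rwa [hsymm]))
      -- Rows are cleared from the bottom up: column `a` vanishes in the rows of the later red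
      -- checkers, so the zeros already made persist. The support does not grow, since red checker
      -- `a` sits on a black checker northwest of `j`.
      refine ⟨v - (v (b.row a) / w (b.row a) a) • w.col a,
        Submodule.sub_mem _ hv (Submodule.smul_mem _ _ (col_mem_range w a)), fun i hi => ?_,
        fun i hi => ?_, fun l hl hql hlb => ?_⟩
      · have h1 : w i a = 0 := hw i a fun h => hi
          ⟨h.1.trans hNW.1, h.2.trans (hblack ▸ hNW.2)⟩
        simp [hsupp i hi, Matrix.col, h1]
      · have h1 : w i a = 0 := supportCoords_eq_zero hw (Or.inr (hi a haj))
        simp [htop i hi, Matrix.col, h1]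
      · rcases hql.eq_or_lt with h | h
        · obtain rfl : l = a := Fin.ext h.symm
          simp [Matrix.col, div_mul_cancel₀ _ (hpiv a)]
        · have h1 : w (b.row l) a = 0 :=
            supportCoords_eq_zero hw (Or.inr (b.row_strictMono (Fin.lt_def.2 h)))
          simp [hred l hl h hlb, Matrix.col, h1]
    · refine ⟨v, hv, hsupp, htop, fun l hl hql hlb => ?_⟩
      rcases hql.eq_or_lt with h | h
      · obtain rfl : l = ⟨q, hq⟩ := Fin.ext h.symm
        by_contra hne
        exact hz ⟨hlb, hne⟩
      · exact hred l hl h hlb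

/-- Reduction to echelon form, without changing the column span. -/
theorem exists_reduced {π : Equiv.Perm (Fin n)} {b : RedCheckers n k}
    {w : Matrix (Fin n) (Fin k) ℂ} (hw : w ∈ supportCoords π b)
    (hpiv : ∀ l, w (b.row l) l ≠ 0) :
    ∃ z ∈ supportCoords π b, LinearMap.range z.mulVecLin = LinearMap.range w.mulVecLin ∧
      (∀ i j, (∀ l < j, b.row l < i) → z i j = w i j) ∧ (∀ j, z (b.row j) j ≠ 0) ∧
      ∀ l j, l ≠ j → π (b.col l) = b.row l → z (b.row l) j = 0 := by
  choose v hv hsupp htop hred using fun j => exists_reduced_col hw hpiv j j 0 (by simp)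
  have hz : (Matrix.of fun i j => v j i) ∈ supportCoords π b := fun i j h => hsupp j i h
  have hpiv' : ∀ j, v j (b.row j) ≠ 0 := fun j => by
    rw [htop j _ fun l hl => b.row_strictMono hl]
    exact hpiv j
  refine ⟨Matrix.of fun i j => v j i, hz,
    range_eq_of_col_mem (rank_eq_of_mem_supportCoords hz hpiv') hv, fun i j h => htop j i h,
    hpiv', fun l j hlj hb => ?_⟩
  rcases lt_or_gt_of_ne hlj with h | h
  · exact hred j l h (Nat.zero_le _) hb
  · exact supportCoords_eq_zero hz (Or.inr (b.row_strictMono h))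

/-- The columns of `m * w` numbered by `S` are `#S` independent vectors of the plane, all in
`blackSpan π b m S`. -/
theorem planes_supportCoords_subset {π : Equiv.Perm (Fin n)} {b : RedCheckers n k}
    {m : Matrix (Fin n) (Fin n) ℂ} {F G : Fin n → Submodule ℂ (Fin n → ℂ)}
    (hm : DefinesPair π m F G) :
    planes m (supportCoords π b) ⊆ checkerboardVariety π b F G := by
  rintro _ ⟨⟨X, hX⟩, ⟨w, hw, rfl⟩, rfl⟩
  refine ⟨m, hm, fun S => ?_⟩
  have hli : LinearIndependent ℂ (m * w).col := by
    rw [linearIndependent_iff_card_eq_finrank_span, Fintype.card_fin]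
    rw [Matrix.rank_eq_finrank_span_cols] at hX
    exact hX.symm
  have h1 : Submodule.span ℂ (Set.range fun j : S => (m * w).col j) ≤
      LinearMap.range (m * w).mulVecLin ⊓ blackSpan π b m S := by
    rw [Submodule.span_le]
    rintro _ ⟨j, rfl⟩
    refine ⟨col_mem_range _ _, ?_⟩
    rw [blackSpan_eq_map]
    refine ⟨w.col j, fun i hi => hw i j fun h => hi ⟨j, j.2, h⟩, ?_⟩
    rfl
  have h2 := finrank_span_eq_card (hli.comp (fun j : S => (j : Fin k)) Subtype.val_injective)
  rw [Fintype.card_coe] at h2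
  rw [← h2]
  exact Submodule.finrank_mono h1

theorem stiefelCoords_subset_supportCoords {π : Equiv.Perm (Fin n)} {b : RedCheckers n k}
    (h : ∀ j, BlackNW π b (π.symm (b.row j)) j) : stiefelCoords π b ⊆ supportCoords π b := by
  intro y hy i j hij
  refine (hy i j).2 (fun h' => hij (h' ▸ h j)) (Or.inl hij)

/-! ### The moving basis. -/

/-- The coordinates in the basis `M` of vectors with given coordinates in the moving basis. -/
noncomputable def fromMoving (r r' : Fin n) (t : ℂ) (z : Matrix (Fin n) (Fin k) ℂ) :
    Matrix (Fin n) (Fin k) ℂ :=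
  Matrix.of fun i j => if i = r then z r j + z r' j else if i = r' then -t * z r j else z i j

/-- The coordinates in the moving basis of vectors with given coordinates in the basis `M`. -/
noncomputable def toMoving (r r' : Fin n) (t : ℂ) (x : Matrix (Fin n) (Fin k) ℂ) :
    Matrix (Fin n) (Fin k) ℂ :=
  Matrix.of fun i j => if i = r then -t⁻¹ * x r' j else
    if i = r' then x r j + t⁻¹ * x r' j else x i j

theorem fromMoving_toMoving {r r' : Fin n} (hr : r ≠ r') {t : ℂ} (ht : t ≠ 0)
    (x : Matrix (Fin n) (Fin k) ℂ) : fromMoving r r' t (toMoving r r' t x) = x := by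
  ext i j
  simp only [fromMoving, toMoving, Matrix.of_apply, if_true, if_neg hr.symm]
  split_ifs with h1 h2
  · subst h1; ring
  · subst h2; field_simp
  · rfl

theorem movingBasis_mul {r r' : Fin n} (hr : r ≠ r') {t : ℂ} (ht : t ≠ 0)
    (M : Matrix (Fin n) (Fin n) ℂ) (z : Matrix (Fin n) (Fin k) ℂ) :
    movingBasis M r r' t * z = M * fromMoving r r' t z := by
  ext i j
  have h1 : ∀ l, movingBasis M r r' t i l * z l j = M i l * z l j +
      ((if l = r' then (M i r - M i r') * z r' j else 0) +
        if l = r then -t * M i r' * z r j else 0) := by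
    intro l
    simp only [movingBasis, if_neg ht, Matrix.updateCol_apply, Matrix.col]
    by_cases h2 : l = r'
    · subst h2; simp [hr.symm]; ring
    · by_cases h3 : l = r
      · subst h3; simp [h2]; ring
      · simp [h2, h3]
  have h2 : ∀ l, M i l * fromMoving r r' t z l j = M i l * z l j +
      ((if l = r' then M i r' * (-t * z r j - z r' j) else 0) +
        if l = r then M i r * z r' j else 0) := by
    intro l
    simp only [fromMoving, Matrix.of_apply]
    by_cases h2 : l = r
    · subst h2; simp [hr]; ring
    · by_cases h3 : l = r'
      · subst h3; simp [h2]; ring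
      · simp [h2, h3]
  rw [Matrix.mul_apply, Matrix.mul_apply, Finset.sum_congr rfl fun l _ => h1 l,
    Finset.sum_congr rfl fun l _ => h2 l]
  simp only [Finset.sum_add_distrib, Finset.sum_ite_eq', Finset.mem_univ, if_true]
  ring

theorem movingBasis_mul_toMoving {r r' : Fin n} (hr : r ≠ r') {t : ℂ} (ht : t ≠ 0)
    (M : Matrix (Fin n) (Fin n) ℂ) (x : Matrix (Fin n) (Fin k) ℂ) :
    movingBasis M r r' t * toMoving r r' t x = M * x := by
  rw [movingBasis_mul hr ht, fromMoving_toMoving hr ht]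

/-- The bases of `F` differ only in column `d`, with `m_{r+1}` replaced by `m_r - t m_{r+1}`. The
vector `m_r` belongs to the ascending column, left of `d`, so for `t ≠ 0` the spans agree. -/
theorem definesPair_movingBasis {σ : Equiv.Perm (Fin n)} {d r r' : Fin n}
    (hσ : MidSort σ d r r') {t : ℂ} (ht : t ≠ 0) {M : Matrix (Fin n) (Fin n) ℂ}
    {F : Fin n → Submodule ℂ (Fin n → ℂ)} (hFM : DefinesPair (nextPerm σ r r') M F (flagOf M)) :
    DefinesPair σ (movingBasis M r r' t) F (flagOf (movingBasis M r r' t)) := by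
  have hr := hσ.lt_next.ne
  have he := hσ.symm_next_lt
  refine ⟨?_, rfl, ?_⟩
  · have h1 := movingBasis_mul_toMoving hr ht M (1 : Matrix (Fin n) (Fin n) ℂ)
    have h2 := hFM.1
    rw [Matrix.mul_one] at h1
    rw [← h1, Matrix.det_mul] at h2
    exact isUnit_of_mul_isUnit_left h2
  rw [hFM.2.2]
  set f : Fin n → Fin n → ℂ := (M.submatrix id (nextPerm σ r r')).col with hf
  set g : Fin n → Fin n → ℂ := ((movingBasis M r r' t).submatrix id σ).col with hg
  have hfd : f d = M.col r' := by
    funext i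
    change M i (nextPerm σ r r' d) = M i r'
    rw [hσ.nextPerm_descending]
  have hfe : f (σ.symm r') = M.col r := by
    funext i
    change M i (nextPerm σ r r' (σ.symm r')) = M i r
    rw [MidSort.nextPerm_ascending]
  have hgd : g d = M.col r - t • M.col r' := by
    funext i
    change movingBasis M r r' t i (σ d) = M i r - t * M i r'
    rw [hσ.descending]
    simp [movingBasis, ht, hr, Matrix.col]
  have hge : g (σ.symm r') = M.col r := by
    funext i
    change movingBasis M r r' t i (σ (σ.symm r')) = M i r
    rw [Equiv.apply_symm_apply]
    simp [movingBasis, ht, Matrix.col]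
  have hfg : ∀ c, c ≠ d → f c = g c := by
    intro c hc
    by_cases hce : c = σ.symm r'
    · rw [hce, hfe, hge]
    · have h1 : σ c ≠ r := fun h => hc (σ.injective (h.trans hσ.descending.symm))
      have h2 : σ c ≠ r' := fun h => hce (by rw [← h, Equiv.symm_apply_apply])
      funext i
      change M i (nextPerm σ r r' c) = movingBasis M r r' t i (σ c)
      rw [MidSort.nextPerm_of_ne h1 h2]
      simp [movingBasis, ht, h1, h2]
  funext c
  change Submodule.span ℂ (f '' Set.Iic c) = Submodule.span ℂ (g '' Set.Iic c)
  apply le_antisymm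
  · rw [Submodule.span_le]
    rintro _ ⟨a, ha, rfl⟩
    by_cases had : a = d
    · have h1 : f a = t⁻¹ • (g (σ.symm r') - g a) := by
        rw [had, hfd, hge, hgd, sub_sub_cancel, smul_smul, inv_mul_cancel₀ ht, one_smul]
      rw [h1]
      refine Submodule.smul_mem _ _ (Submodule.sub_mem _ (Submodule.subset_span ?_)
        (Submodule.subset_span ⟨a, ha, rfl⟩))
      exact ⟨_, he.le.trans (had ▸ ha), rfl⟩
    · rw [hfg a had]
      exact Submodule.subset_span ⟨a, ha, rfl⟩
  · rw [Submodule.span_le]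
    rintro _ ⟨a, ha, rfl⟩
    by_cases had : a = d
    · have h1 : g a = f (σ.symm r') - t • f a := by
        rw [had, hfd, hfe, hgd]
      rw [h1]
      refine Submodule.sub_mem _ (Submodule.subset_span ?_)
        (Submodule.smul_mem _ _ (Submodule.subset_span ⟨a, ha, rfl⟩))
      exact ⟨_, he.le.trans (had ▸ ha), rfl⟩
    · rw [← hfg a had]
      exact Submodule.subset_span ⟨a, ha, rfl⟩

/-! ### Swap moves and the modified coordinates. -/

variable {σ : Equiv.Perm (Fin n)} {d r r' : Fin n} {s s' : Fin k}
  {parent child : RedCheckers n k}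

namespace MidSort

theorem symm_nextPerm_r : (nextPerm σ r r').symm r = σ.symm r' := by
  rw [Equiv.symm_apply_eq, nextPerm_ascending]

theorem symm_nextPerm_r' (hσ : MidSort σ d r r') : (nextPerm σ r r').symm r' = d := by
  rw [Equiv.symm_apply_eq, hσ.nextPerm_descending]

theorem symm_nextPerm_of_ne {i : Fin n} (h1 : i ≠ r) (h2 : i ≠ r') :
    (nextPerm σ r r').symm i = σ.symm i := by
  rw [Equiv.symm_apply_eq, nextPerm_of_ne, Equiv.apply_symm_apply] <;>
    rwa [Equiv.apply_symm_apply]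

theorem symm_descending (hσ : MidSort σ d r r') : σ.symm r = d := by
  rw [Equiv.symm_apply_eq, hσ.descending]

theorem symm_eq_iff (hσ : MidSort σ d r r') {i : Fin n} : σ.symm i = d ↔ i = r := by
  rw [Equiv.symm_apply_eq, hσ.descending]

theorem symm_le_symm (hσ : MidSort σ d r r') {i j : Fin n} (hi : σ.symm i < d)
    (hj : σ.symm j < d) (hij : i ≤ j) : σ.symm i ≤ σ.symm j := by
  rw [← hσ.regionBE.le_iff_le hi hj]
  simpa using hij

theorem lt_of_symm_gt (hσ : MidSort σ d r r') {i : Fin n} (hi : d < σ.symm i) : i < r := by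
  simpa using hσ.regionA_lt hi

theorem symm_lt_of_gt (hσ : MidSort σ d r r') {i : Fin n} (hi : r < i) : σ.symm i < d := by
  rcases lt_trichotomy (σ.symm i) d with h | h | h
  · exact h
  · exact absurd (hσ.symm_eq_iff.1 h) hi.ne'
  · exact absurd (hσ.lt_of_symm_gt h) hi.not_gt

end MidSort

namespace SwapMove

theorem symm_row_s' (hm : SwapMove σ d r r' s s' parent child) :
    σ.symm (parent.row s') = parent.col s' := by
  rw [Equiv.symm_apply_eq, hm.top.1.2.2]

/-- A red checker in row `r + 1` is the top one in the critical diagonal. -/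
theorem eq_s'_of_row (hm : SwapMove σ d r r' s s' parent child) (hp : IsSortedNode σ parent d)
    (hσ : MidSort σ d r r') {j : Fin k} (hj : parent.row j = r') : j = s' := by
  have h1 := hp.row_notMem_gap hσ hm (j := j) (hj ▸ hσ.lt_next)
  have h2 := hσ.next_le hm.top.1.2.1
  exact parent.row_strictMono.injective (le_antisymm (hj ▸ h2) h1)

theorem lt_row_of_ne (hm : SwapMove σ d r r' s s' parent child) (hp : IsSortedNode σ parent d)
    (hσ : MidSort σ d r r') {j : Fin k} (hj : j ≠ s') (h : r < parent.row j) :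
    parent.row s' < parent.row j :=
  lt_of_le_of_ne (hp.row_notMem_gap hσ hm h) (parent.row_strictMono.injective.ne hj).symm

theorem row_ne_r (hm : SwapMove σ d r r' s s' parent child) {j : Fin k} (hj : j ≠ s) :
    parent.row j ≠ r := fun h => parent.row_strictMono.injective.ne hj (h.trans hm.critical.symm)

theorem ascending_le_col (hm : SwapMove σ d r r' s s' parent child) (hσ : MidSort σ d r r') :
    σ.symm r' ≤ parent.col s' := by
  rw [← hm.symm_row_s']
  exact hσ.symm_le_symm hσ.symm_next_lt (hm.symm_row_s' ▸ hm.top.1.1)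
    (hσ.next_le hm.top.1.2.1)

/-- With `row_notMem_gap`, this puts `s'` northwest of every red checker below row `r`, so multiples
of column `s'` can be subtracted from their columns without enlarging the supports. -/
theorem col_s'_le_col (hm : SwapMove σ d r r' s s' parent child) (hp : IsSortedNode σ parent d)
    (hσ : MidSort σ d r r') {j : Fin k} (hj : r < parent.row j) :
    parent.col s' ≤ parent.col j := by
  rcases lt_or_ge (parent.col j) d with h | h
  · have h1 : σ.symm (parent.row j) = parent.col j := by
      rw [Equiv.symm_apply_eq, hp.on_black j h]
    rw [← hm.symm_row_s', ← h1]
    exact hσ.symm_le_symm (hm.symm_row_s' ▸ hm.top.1.1) (h1 ▸ h) (hp.row_notMem_gap hσ hm hj)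
  · exact hm.top.1.1.le.trans h

end SwapMove

theorem stiefelCoords_one {π : Equiv.Perm (Fin n)} {b : RedCheckers n k}
    {y : Matrix (Fin n) (Fin k) ℂ} (hy : y ∈ stiefelCoords π b) (j : Fin k) :
    y (b.row j) j = 1 := (hy _ j).1 rfl

/-- For `t = 0`, column `s` is multiplied by `y_{r+1,s'}`. -/
theorem modifiedMatrix_zero (hσ : MidSort σ d r r') (hp : IsSortedNode σ parent d)
    (hm : SwapMove σ d r r' s s' parent child) {y : Matrix (Fin n) (Fin k) ℂ}
    (hy : y ∈ stiefelCoords (nextPerm σ r r') child) (i : Fin n) (j : Fin k) :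
    modifiedMatrix σ d r r' s s' 0 y i j = if j = s then y r' s' * y i j else y i j := by
  have hc := hm.isSortedNode hp hσ
  have hys := stiefelCoords_subset_supportCoords hc.blackNW_pivot hy
  simp only [modifiedMatrix, Matrix.of_apply]
  -- In row `r'` and in the remaining rows of A and E the formula gives `0` in column `s`. So does
  -- `y`, since `s` of the child is in row `r` and in the column of the ascending checker.
  split_ifs with hj h1 h2 h3 h4
  · subst hj
    have h := stiefelCoords_one hy j
    rw [hm.row_eq, hm.critical] at h
    rw [h1, h, mul_one]
  · have h : y i j = 0 := supportCoords_eq_zero hys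
      (Or.inr (by rw [hj, hm.row_eq, hm.critical, h2]; exact hσ.lt_next))
    simp [h]
  · have h : y i j = 0 := supportCoords_eq_zero hys (Or.inl (by
      rw [hj, hm.col_s, MidSort.symm_nextPerm_of_ne h1 h2]
      exact hσ.symm_next_lt.trans h3))
    simp [h]
  · rw [hj]
  · have h : y i j = 0 := supportCoords_eq_zero hys (Or.inr (by
      rw [hj, hm.row_eq, hm.critical]
      have h5 : σ.symm i < d := lt_of_le_of_ne (not_lt.1 h3) fun h => h1 (hσ.symm_eq_iff.1 h)
      exact lt_of_le_of_ne (not_lt.1 fun h => h4 ⟨h5, h⟩) (Ne.symm h1)))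
    simp [h]
  · rfl

theorem modifiedMatrix_zero_mem (hσ : MidSort σ d r r') (hp : IsSortedNode σ parent d)
    (hm : SwapMove σ d r r' s s' parent child) :
    modifiedCoords σ d r r' s s' child 0 ⊆ supportCoords (nextPerm σ r r') child := by
  rintro _ ⟨y, hy, rfl⟩ i j hij
  have hys := stiefelCoords_subset_supportCoords (hm.isSortedNode hp hσ).blackNW_pivot hy
  rw [modifiedMatrix_zero hσ hp hm hy, hys i j hij]
  simp

/-- For `t = 0`, the modified coordinates parametrize almost all planes. -/
theorem planes_subset_modifiedCoords_zero (hσ : MidSort σ d r r') (hp : IsSortedNode σ parent d)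
    (hm : SwapMove σ d r r' s s' parent child) (M : Matrix (Fin n) (Fin n) ℂ) :
    planes M {w ∈ supportCoords (nextPerm σ r r') child |
      (∀ j, w (child.row j) j ≠ 0) ∧ w r' s' ≠ 0} ⊆
    planes M (modifiedCoords σ d r r' s s' child 0) := by
  refine planes_subset ?_
  rintro w ⟨hw, hpiv, hne⟩ -
  obtain ⟨z, hz, hrange, htop, hzpiv, hred⟩ := exists_reduced hw hpiv
  have hzne : z r' s' ≠ 0 := by
    -- All red checkers before `s'` are above row `r'`, so the reduction does not touch this entry.
    rw [htop r' s' fun l hl => ?_]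
    · exact hne
    rw [hm.row_eq]
    have h1 := parent.row_strictMono hl
    by_contra! h2
    exact h1.not_ge (hp.row_notMem_gap hσ hm (hσ.lt_next.trans_le h2))
  have hzrank := rank_eq_of_mem_supportCoords hz hzpiv
  let y : Matrix (Fin n) (Fin k) ℂ := Matrix.of fun i j => z i j / z (child.row j) j
  have hyv : ∀ i j, y i j = z i j / z (child.row j) j := fun i j => rfl
  have hy : y ∈ stiefelCoords (nextPerm σ r r') child := by
    refine fun i j => ⟨fun h => ?_, fun hij h => ?_⟩
    · rw [hyv, h, div_self (h ▸ hzpiv j)]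
    · rw [hyv]
      rcases h with h | ⟨l, hl, hli, hlc⟩
      · rw [hz i j h, zero_div]
      · rw [← hli, hred l j hl (by rw [hlc, hli, Equiv.apply_symm_apply]), zero_div]
  refine ⟨_, ⟨y, hy, rfl⟩, range_mul_congr M ?_⟩
  rw [← hrange]
  refine (range_eq_of_col_mem hzrank fun j => ?_).symm
  obtain ⟨c, hc0, hc⟩ : ∃ c : ℂ, c ≠ 0 ∧
      (modifiedMatrix σ d r r' s s' 0 y).col j = c • z.col j := by
    by_cases hj : j = s
    · refine ⟨y r' s' / z (child.row j) j, div_ne_zero (div_ne_zero hzne (hzpiv _)) (hzpiv j), ?_⟩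
      funext i
      change modifiedMatrix σ d r r' s s' 0 y i j = y r' s' / z (child.row j) j * z i j
      rw [modifiedMatrix_zero hσ hp hm hy, if_pos hj, hyv i j]
      ring
    · refine ⟨(z (child.row j) j)⁻¹, inv_ne_zero (hzpiv j), ?_⟩
      funext i
      change modifiedMatrix σ d r r' s s' 0 y i j = (z (child.row j) j)⁻¹ * z i j
      rw [modifiedMatrix_zero hσ hp hm hy, if_neg hj, hyv i j]
      ring
  have h1 : z.col j = c⁻¹ • (modifiedMatrix σ d r r' s s' 0 y).col j := by
    rw [hc, smul_smul, inv_mul_cancel₀ hc0, one_smul]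
  rw [h1]
  exact Submodule.smul_mem _ _ (col_mem_range _ j)

/-- For `t ≠ 0`, the modified coordinates parametrize planes with the supports prescribed by the
parent checkerboard and the moving basis. -/
theorem planes_modifiedCoords_subset (hσ : MidSort σ d r r') (hp : IsSortedNode σ parent d)
    (hm : SwapMove σ d r r' s s' parent child) {t : ℂ} (ht : t ≠ 0)
    (M : Matrix (Fin n) (Fin n) ℂ) :
    planes M (modifiedCoords σ d r r' s s' child t) ⊆
      planes (movingBasis M r r' t) (supportCoords σ parent) := by
  have hr := hσ.lt_next.ne
  have hds := hp.le_col_of_row_eq hσ hm.critical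
  obtain ⟨hs'd, hs'r, hs'σ⟩ := hm.top.1
  refine planes_subset ?_
  rintro _ ⟨y, hy, rfl⟩ -
  have hys := stiefelCoords_subset_supportCoords (hm.isSortedNode hp hσ).blackNW_pivot hy
  set Y := modifiedMatrix σ d r r' s s' t y with hY
  -- Adding `t⁻¹` times column `s` to column `s'` cancels region A and row `r'`, hence also the
  -- coordinate along `m_r - t m_{r+1}`. In column `s`, the entries in rows `r` and `r'` combine to
  -- `y_{r+1,s'} (m_r - t m_{r+1})`.
  set C : Matrix (Fin k) (Fin k) ℂ := Matrix.transvection s s' t⁻¹ with hC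
  have hCdet : IsUnit C.det := by
    rw [hC, Matrix.det_transvection_of_ne _ _ hm.ne]
    exact isUnit_one
  refine ⟨toMoving r r' t (Y * C), ?_, by
    rw [movingBasis_mul_toMoving hr ht]
    exact range_mul_congr M (range_mulVecLin_mul_of_isUnit hCdet)⟩
  have hx : ∀ i j, j ≠ s' → (Y * C) i j = Y i j := fun i j hj =>
    Matrix.mul_transvection_apply_of_ne _ _ _ _ hj _ _
  have hx' : ∀ i, (Y * C) i s' = Y i s' + t⁻¹ * Y i s := fun i =>
    Matrix.mul_transvection_apply_same _ _ _ _ _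
  have hYne : ∀ i j, j ≠ s → Y i j = y i j := fun i j hj => by
    simp [hY, modifiedMatrix, hj]
  have hYr : Y r s = y r' s' := by simp [hY, modifiedMatrix]
  have hYr' : Y r' s = -t * y r' s' := by simp [hY, modifiedMatrix, hr.symm]
  have hYA : ∀ i, d < σ.symm i → Y i s = -t * y i s' := fun i hi => by
    have h1 := hσ.lt_of_symm_gt hi
    simp [hY, modifiedMatrix, h1.ne, (h1.trans hσ.lt_next).ne, hi]
  have hYE : ∀ i, r < i → i ≠ r' → Y i s = 0 := fun i hi hi' => by
    simp [hY, modifiedMatrix, hi.ne', hi', (hσ.symm_lt_of_gt hi).not_gt, hi.not_gt]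
  intro i j hij
  rw [BlackNW, Equiv.apply_symm_apply, not_and_or, not_le, not_le] at hij
  simp only [toMoving, Matrix.of_apply]
  by_cases hjs : j = s
  · subst hjs
    rw [hm.critical] at hij
    rw [hx _ _ hm.ne, hx _ _ hm.ne, hx _ _ hm.ne]
    split_ifs with h1 h2
    · rw [h1, hσ.symm_descending] at hij
      exact absurd hij (not_or.2 ⟨hds.not_gt, lt_irrefl _⟩)
    · rw [hYr, hYr']
      field_simp
      ring
    · rcases lt_or_ge r i with h3 | h3
      · exact hYE i h3 h2
      · have h4 := hij.resolve_right h3.not_gt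
        rw [hYA i (hds.trans_lt h4), supportCoords_eq_zero hys (Or.inl ?_), mul_zero]
        rwa [hm.col_s', MidSort.symm_nextPerm_of_ne h1 h2]
  by_cases hjs' : j = s'
  · subst hjs'
    rw [hx', hx', hx', hYne _ _ hjs, hYne _ _ hjs, hYne _ _ hjs]
    split_ifs with h1 h2
    · rw [hYr']
      field_simp
      ring
    · rw [h2] at hij
      exact absurd hij (not_or.2 ⟨(hm.ascending_le_col hσ).not_gt, (hσ.next_le hs'r).not_gt⟩)
    · rcases lt_trichotomy d (σ.symm i) with h3 | h3 | h3
      · rw [hYA i h3]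
        field_simp
        ring
      · exact absurd (hσ.symm_eq_iff.1 h3.symm) h1
      · have h4 : parent.row j < i := by
          by_contra! h4
          refine hij.elim (fun h5 => h5.not_ge ?_) h4.not_gt
          rw [← hm.symm_row_s']
          exact hσ.symm_le_symm h3 (hm.symm_row_s' ▸ hs'd) h4
        rw [hYE i (hs'r.trans h4) h2, supportCoords_eq_zero hys (Or.inr ?_)]
        · ring
        · rwa [hm.row_eq]
  · rw [hx _ _ hjs', hx _ _ hjs', hx _ _ hjs', hYne _ _ hjs, hYne _ _ hjs, hYne _ _ hjs]
    have hrow : child.row j = parent.row j := by rw [hm.row_eq]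
    have hcol := hm.col_of_ne hjs hjs'
    have hrj := hm.row_ne_r hjs
    have hr'0 : parent.col j < d ∨ parent.row j < r' → y r' j = 0 := fun h =>
      supportCoords_eq_zero hys (by rwa [hrow, hcol, hσ.symm_nextPerm_r'])
    split_ifs with h1 h2
    · rw [h1, hσ.symm_descending] at hij
      rw [hr'0 (hij.imp_right fun h => h.trans hσ.lt_next), mul_zero]
    · rw [h2] at hij
      rw [hr'0 (hij.imp_left fun h => h.trans hσ.symm_next_lt), supportCoords_eq_zero hys ?_]
      · ring
      · rw [hrow, hcol, MidSort.symm_nextPerm_r]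
        refine hij.imp_right fun h => ?_
        by_contra! h3
        exact h.not_ge (hσ.next_le (lt_of_le_of_ne h3 hrj.symm))
    · refine supportCoords_eq_zero hys ?_
      rwa [hrow, hcol, MidSort.symm_nextPerm_of_ne h1 h2]

/-! ### Solving for the echelon matrix when `t ≠ 0`. -/

/-- The echelon matrix that stands for a reduced matrix `z` of coordinates in the moving basis. -/
noncomputable def echelonOf (σ : Equiv.Perm (Fin n)) (d r r' : Fin n) (s s' : Fin k)
    (parent : RedCheckers n k) (t μ : ℂ) (z : Matrix (Fin n) (Fin k) ℂ) :
    Matrix (Fin n) (Fin k) ℂ :=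
  Matrix.of fun i j =>
    let x := fromMoving r r' t z
    -- Region A is omitted, as the modified column `s` takes those entries from column `s'`.
    if j = s then if σ.symm i ≤ d then z i s / z r s else 0
    -- Chosen so that the modified column `s` plus `t` times column `s'` is `μ` times column `s'` of
    -- `x`.
    else if j = s' then (μ * x i s' - μ * z r' s' / z r s * x i s) / t
    -- Column `s'` clears row `r`, where `s` of the child sits on the black checker; `x r s' = z r'
    -- s'` because `z r s' = 0`.
    else (x i j - x r j / z r' s' * x i s') / z (parent.row j) j

section Reduced

variable (hσ : MidSort σ d r r') (hp : IsSortedNode σ parent d)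
  (hm : SwapMove σ d r r' s s' parent child) {t μ : ℂ} (ht : t ≠ 0)
  {z : Matrix (Fin n) (Fin k) ℂ} (hz : z ∈ supportCoords σ parent)
  (hpiv : ∀ j, z (parent.row j) j ≠ 0) (hne : z r' s' ≠ 0)
  (hred : ∀ l j, l ≠ j → σ (parent.col l) = parent.row l → z (parent.row l) j = 0)
  (hμ : if parent.row s' = r' then μ * z r' s' = 1 else μ * z (parent.row s') s' = t)

include hσ hm hz in
theorem reduced_facts : z r' s = 0 ∧ z r s' = 0 ∧ (∀ i, r < i → z i s = 0) ∧
    (∀ i, d < σ.symm i → z i s' = 0) ∧ ∀ i, parent.row s' < i → z i s' = 0 := by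
  have hs'd := hm.top.1.1
  have h : ∀ i, r < i → z i s = 0 := fun i hi =>
    supportCoords_eq_zero hz (Or.inr (hm.critical ▸ hi))
  refine ⟨h r' hσ.lt_next, supportCoords_eq_zero hz (Or.inl ?_), h,
    fun i hi => supportCoords_eq_zero hz (Or.inl (hs'd.trans hi)),
    fun i hi => supportCoords_eq_zero hz (Or.inr hi)⟩
  rwa [hσ.symm_descending]

include hσ hp hm ht hz hpiv hne hred hμ in
theorem echelonOf_mem_stiefelCoords :
    echelonOf σ d r r' s s' parent t μ z ∈ stiefelCoords (nextPerm σ r r') child := by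
  have hr := hσ.lt_next.ne
  have hds := hp.le_col_of_row_eq hσ hm.critical
  obtain ⟨hs'd, hs'r, hs'σ⟩ := hm.top.1
  obtain ⟨z1, z2, z3, z4, z5⟩ := reduced_facts hσ hm hz
  have hA : z r s ≠ 0 := by
    have := hpiv s
    rwa [hm.critical] at this
  -- red checkers of the child in squares of black checkers
  have hblack : ∀ l j i, l ≠ j → l ≠ s → l ≠ s' → child.row l = i →
      child.col l = (nextPerm σ r r').symm i → z i j = 0 := by
    intro l j i hlj hls hls' hli hlc
    rw [hm.row_eq] at hli
    have h1 : i ≠ r := fun h => hm.row_ne_r hls (hli.trans h)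
    have h2 : i ≠ r' := fun h => hls' (hm.eq_s'_of_row hp hσ (hli.trans h))
    rw [hm.col_of_ne hls hls', MidSort.symm_nextPerm_of_ne h1 h2] at hlc
    rw [← hli]
    exact hred l j hlj (by rw [hlc, hli, Equiv.apply_symm_apply])
  intro i j
  rw [hm.row_eq]
  have hNW : BlackNW (nextPerm σ r r') child ((nextPerm σ r r').symm i) j ↔
      (nextPerm σ r r').symm i ≤ child.col j ∧ i ≤ parent.row j := by
    rw [BlackNW, Equiv.apply_symm_apply, hm.row_eq]
  rw [hNW]
  by_cases hjs : j = s
  · subst hjs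
    simp only [echelonOf, Matrix.of_apply, if_true]
    refine ⟨fun h => ?_, fun hij h => ?_⟩
    · rw [← h, hm.critical, hσ.symm_descending, if_pos le_rfl, div_self hA]
    · rw [hm.critical] at hij h
      split_ifs with h0
      swap
      · rfl
      rcases lt_or_gt_of_ne hij with h1 | h1
      · rw [z3 i h1, zero_div]
      · have h2 : i ≠ r' := (h1.trans hσ.lt_next).ne
        rcases h with h | ⟨l, hl, hli, hlc⟩
        · refine absurd ⟨?_, h1.le⟩ h
          rw [hm.col_s, MidSort.symm_nextPerm_of_ne h1.ne h2]
          exact hσ.symm_le_symm (lt_of_le_of_ne h0 fun h => h1.ne (hσ.symm_eq_iff.1 h))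
            hσ.symm_next_lt (h1.trans hσ.lt_next).le
        · have hls' : l ≠ s' := by
            rintro rfl
            rw [hli] at hs'r
            exact h1.not_gt hs'r
          have := hblack l j i hl hl hls' (by rw [hm.row_eq, hli]) hlc
          rw [this, zero_div]
  by_cases hjs' : j = s'
  · subst hjs'
    simp only [echelonOf, Matrix.of_apply, if_neg hjs, if_true]
    refine ⟨fun h => ?_, fun hij h => ?_⟩
    · subst h
      by_cases hR : parent.row j = r'
      · rw [if_pos hR] at hμ
        simp only [hR, fromMoving, Matrix.of_apply, if_neg hr.symm, if_true, z2, hμ]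
        field_simp
        ring
      · rw [if_neg hR] at hμ
        simp only [fromMoving, Matrix.of_apply, if_neg hs'r.ne', if_neg hR, hμ, z3 _ hs'r]
        field_simp
        ring
    · by_cases h1 : i = r
      · subst h1
        simp only [fromMoving, Matrix.of_apply, if_true, z1, z2]
        field_simp
        ring
      by_cases h2 : i = r'
      · subst h2
        exfalso
        rcases h with h | ⟨l, hl, hli, hlc⟩
        · refine h ⟨?_, hσ.next_le hs'r⟩
          rwa [hm.col_s', hσ.symm_nextPerm_r']
        · exact hl (hm.eq_s'_of_row hp hσ hli)
      have h3 : z i j = 0 ∧ z i s = 0 := by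
        rcases h with h | ⟨l, hl, hli, hlc⟩
        · rw [hm.col_s', MidSort.symm_nextPerm_of_ne h1 h2, not_and_or, not_le, not_le] at h
          refine ⟨supportCoords_eq_zero hz (h.imp_left (hs'd.le.trans hds).trans_lt),
            supportCoords_eq_zero hz (h.imp_right fun h => ?_)⟩
          rw [hm.critical]
          exact hs'r.trans h
        · have hls : l ≠ s := by
            rintro rfl
            exact h1 (hli.symm.trans hm.critical)
          have := hblack l j i hl hls hl (by rw [hm.row_eq, hli]) hlc
          have := hblack l s i hls hls hl (by rw [hm.row_eq, hli]) hlc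
          exact ⟨‹_›, ‹_›⟩
      simp [fromMoving, h1, h2, h3.1, h3.2]
  · simp only [echelonOf, Matrix.of_apply, if_neg hjs, if_neg hjs']
    have hrj := hm.row_ne_r hjs
    have hr'j : parent.row j ≠ r' := fun h => hjs' (hm.eq_s'_of_row hp hσ h)
    have hcol := hm.col_of_ne hjs hjs'
    have hκ : parent.row j < r → z r j + z r' j = 0 := fun h => by
      rw [supportCoords_eq_zero hz (Or.inr h),
        supportCoords_eq_zero hz (Or.inr (h.trans hσ.lt_next)), add_zero]
    refine ⟨fun h => ?_, fun hij h => ?_⟩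
    · subst h
      simp only [fromMoving, Matrix.of_apply, if_true, if_neg hrj, if_neg hr'j]
      have : (z r j + z r' j) / z r' s' * z (parent.row j) s' = 0 := by
        rcases lt_or_gt_of_ne hrj with h | h
        · rw [hκ h]; simp
        · rw [z5 _ (hm.lt_row_of_ne hp hσ hjs' h), mul_zero]
      rw [this, sub_zero, div_self (hpiv j)]
    · by_cases h1 : i = r
      · subst h1
        simp only [fromMoving, Matrix.of_apply, if_true, z2]
        field_simp
        ring
      by_cases h2 : i = r'
      · subst h2
        have h3 : z r j = 0 := by
          have h4 : parent.col j < d ∨ parent.row j < r := by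
            rcases h with h | ⟨l, hl, hli, hlc⟩
            · rw [hcol, hσ.symm_nextPerm_r', not_and_or, not_le, not_le] at h
              refine h.imp_right fun h => ?_
              by_contra! h5
              exact h.not_ge (hσ.next_le (lt_of_le_of_ne h5 hrj.symm))
            -- Here `s'` is in row `r'` and gets column `d` from `s`, so every red checker to the
            -- right of `d` in the parent is above row `r`.
            · obtain rfl := hm.eq_s'_of_row hp hσ hli
              rw [hm.col_s', hσ.symm_nextPerm_r'] at hlc
              rw [or_iff_not_imp_left, not_lt]
              intro h5
              rw [← hm.critical]
              refine hp.antichain s j hds (lt_of_le_of_ne (hlc ▸ h5) fun h => hjs ?_)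
              exact (parent.col_injective h).symm
          exact supportCoords_eq_zero hz (h4.imp_left fun h => by rwa [hσ.symm_descending])
        simp [fromMoving, hr.symm, h3, z2]
      -- Either nothing is subtracted from column `j`, or column `s'` vanishes in row `i` too.
      have h3 : z i j = 0 ∧ (z r j + z r' j = 0 ∨ z i s' = 0) := by
        rcases h with h | ⟨l, hl, hli, hlc⟩
        · rw [hcol, MidSort.symm_nextPerm_of_ne h1 h2, not_and_or, not_le, not_le] at h
          refine ⟨supportCoords_eq_zero hz h, ?_⟩
          rcases lt_or_gt_of_ne hrj with h4 | h4
          · exact Or.inl (hκ h4)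
          · exact Or.inr (supportCoords_eq_zero hz (h.imp
              (hm.col_s'_le_col hp hσ h4).trans_lt (hp.row_notMem_gap hσ hm h4).trans_lt))
        · have hls : l ≠ s := by
            rintro rfl
            exact h1 (hli.symm.trans hm.critical)
          have hls' : l ≠ s' := by
            rintro rfl
            rw [hm.col_s', MidSort.symm_nextPerm_of_ne h1 h2, ← hli, hm.symm_row_s'] at hlc
            exact (hs'd.trans_le hds).ne hlc.symm
          exact ⟨hblack l j i hl hls hls' (by rw [hm.row_eq, hli]) hlc,
            Or.inr (hblack l s' i hls' hls hls' (by rw [hm.row_eq, hli]) hlc)⟩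
      rcases h3 with ⟨h3, h4 | h4⟩ <;> simp [fromMoving, h1, h2, h3, h4]

include hσ hm ht hz hpiv hne hμ in
theorem fromMoving_col_mem_range (j : Fin k) : (fromMoving r r' t z).col j ∈ LinearMap.range
    (modifiedMatrix σ d r r' s s' t (echelonOf σ d r r' s s' parent t μ z)).mulVecLin := by
  have hr := hσ.lt_next.ne
  have hs'd := hm.top.1.1
  have hss' := hm.ne
  obtain ⟨z1, z2, z3, z4, z5⟩ := reduced_facts hσ hm hz
  have hA : z r s ≠ 0 := by
    have := hpiv s
    rwa [hm.critical] at this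
  have hμ0 : μ ≠ 0 := by
    rintro rfl
    split_ifs at hμ <;> simp [ht.symm] at hμ
  set x := fromMoving r r' t z with hx
  set y := echelonOf σ d r r' s s' parent t μ z with hy
  set Y := modifiedMatrix σ d r r' s s' t y with hY
  have xr : ∀ j, x r j = z r j + z r' j := fun j => by simp [hx, fromMoving]
  have xr' : ∀ j, x r' j = -t * z r j := fun j => by simp [hx, fromMoving, hr.symm]
  have xi : ∀ i j, i ≠ r → i ≠ r' → x i j = z i j := fun i j h1 h2 => by
    simp [hx, fromMoving, h1, h2]
  have hys : ∀ i, y i s = if σ.symm i ≤ d then z i s / z r s else 0 := fun i => by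
    simp [hy, echelonOf]
  have hys' : ∀ i, y i s' = (μ * x i s' - μ * z r' s' / z r s * x i s) / t := fun i => by
    simp [hy, echelonOf, hss'.symm, hx]
  have hyr' : y r' s' = μ * z r' s' := by
    rw [hys', xr', xr', z2]
    field_simp
    ring
  -- The two sources of the modified column, column `s'` in region A and column `s` in region B, fit
  -- together to a multiple of one column of `x`.
  have hYs : ∀ i, Y i s = μ * z r' s' / z r s * x i s := by
    intro i
    by_cases h1 : i = r
    · subst h1
      simp only [hY, modifiedMatrix, Matrix.of_apply, if_true, hyr', xr, z1]
      field_simp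
      ring
    by_cases h2 : i = r'
    · subst h2
      simp only [hY, modifiedMatrix, Matrix.of_apply, if_true, if_neg hr.symm, hyr', xr']
      field_simp
    rw [xi i s h1 h2]
    by_cases h3 : d < σ.symm i
    · simp only [hY, modifiedMatrix, Matrix.of_apply, if_true, if_neg h1, if_neg h2, if_pos h3,
        hys', xi i _ h1 h2, z4 i h3]
      field_simp
      ring
    have h4 : σ.symm i < d := lt_of_le_of_ne (not_lt.1 h3) fun h => h1 (hσ.symm_eq_iff.1 h)
    by_cases h5 : i < r
    · simp only [hY, modifiedMatrix, Matrix.of_apply, if_true, if_neg h1, if_neg h2, if_neg h3,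
        if_pos (And.intro h4 h5), hys, if_pos h4.le, hyr']
      field_simp
    · have h6 : r < i := lt_of_le_of_ne (not_lt.1 h5) (Ne.symm h1)
      simp [hY, modifiedMatrix, h1, h2, h3, h5, z3 i h6]
  have hYne : ∀ i j, j ≠ s → Y i j = y i j := fun i j hj => by
    simp [hY, modifiedMatrix, hj]
  have hs : x.col s = (μ * z r' s' / z r s)⁻¹ • Y.col s := by
    funext i
    change x i s = (μ * z r' s' / z r s)⁻¹ * Y i s
    rw [hYs]
    field_simp
  have hs' : x.col s' = μ⁻¹ • (Y.col s + t • Y.col s') := by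
    funext i
    change x i s' = μ⁻¹ * (Y i s + t * Y i s')
    rw [hYs, hYne _ _ hss'.symm, hys']
    field_simp
    ring
  have hs'mem : x.col s' ∈ LinearMap.range Y.mulVecLin := by
    rw [hs']
    exact Submodule.smul_mem _ _ (Submodule.add_mem _ (col_mem_range Y s)
      (Submodule.smul_mem _ _ (col_mem_range Y s')))
  by_cases hjs : j = s
  · rw [hjs, hs]
    exact Submodule.smul_mem _ _ (col_mem_range Y s)
  by_cases hjs' : j = s'
  · rw [hjs']
    exact hs'mem
  · have hj : x.col j = z (parent.row j) j • Y.col j + (x r j / z r' s') • x.col s' := by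
      funext i
      change x i j = z (parent.row j) j * Y i j + x r j / z r' s' * x i s'
      have hyj : y i j = (x i j - x r j / z r' s' * x i s') / z (parent.row j) j := by
        simp [hy, echelonOf, hjs, hjs', hx]
      rw [hYne _ _ hjs, hyj, mul_div_cancel₀ _ (hpiv j)]
      ring
    rw [hj]
    exact Submodule.add_mem _ (Submodule.smul_mem _ _ (col_mem_range Y j))
      (Submodule.smul_mem _ _ hs'mem)

end Reduced

/-- For `t ≠ 0`, the modified coordinates parametrize almost all planes with the supports
prescribed by the parent checkerboard. -/
theorem planes_subset_modifiedCoords (hσ : MidSort σ d r r') (hp : IsSortedNode σ parent d)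
    (hm : SwapMove σ d r r' s s' parent child) {t : ℂ} (ht : t ≠ 0)
    (M : Matrix (Fin n) (Fin n) ℂ) :
    planes (movingBasis M r r' t) {w ∈ supportCoords σ parent |
      (∀ j, w (parent.row j) j ≠ 0) ∧ w r' s' ≠ 0} ⊆
    planes M (modifiedCoords σ d r r' s s' child t) := by
  refine planes_subset ?_
  rintro w ⟨hw, hpiv, hne⟩ hrank
  obtain ⟨z, hz, hrange, htop, hzpiv, hred⟩ := exists_reduced hw hpiv
  have hzne : z r' s' ≠ 0 := by
    rw [htop r' s' fun l hl => ?_]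
    · exact hne
    have h1 := parent.row_strictMono hl
    by_contra! h2
    exact h1.not_ge (hp.row_notMem_gap hσ hm (hσ.lt_next.trans_le h2))
  -- `μ` makes the pivot of column `s'` equal to `1`. That entry is `μ z_{r+1,s'}` in row `r + 1`,
  -- but `μ z_{R,s'} / t` in a lower row `R`.
  obtain ⟨μ, hμ⟩ : ∃ μ : ℂ,
      if parent.row s' = r' then μ * z r' s' = 1 else μ * z (parent.row s') s' = t := by
    split_ifs
    · exact ⟨(z r' s')⁻¹, inv_mul_cancel₀ hzne⟩
    · exact ⟨t / z (parent.row s') s', div_mul_cancel₀ _ (hzpiv s')⟩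
  refine ⟨_, ⟨_, echelonOf_mem_stiefelCoords hσ hp hm ht hz hzpiv hzne hred hμ, rfl⟩, ?_⟩
  have h1 := range_mul_congr (movingBasis M r r' t) hrange
  rw [Matrix.rank, ← h1] at hrank
  rw [← h1]
  refine (range_eq_of_col_mem hrank fun j => ?_).symm
  rw [movingBasis_mul hσ.lt_next.ne ht]
  obtain ⟨v, hv⟩ := fromMoving_col_mem_range hσ hm ht hz hzpiv hzne hμ j
  refine ⟨v, ?_⟩
  rw [Matrix.mulVecLin_apply, ← Matrix.mulVec_mulVec, ← Matrix.mulVecLin_apply _ v, hv]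
  rfl

/-- Planes with generic coordinates are dense in the checkerboard variety. -/
theorem checkerboardVariety_subset_closure_generic {π : Equiv.Perm (Fin n)} {b : RedCheckers n k}
    {d : Fin n} (hb : IsSortedNode π b d) {m : Matrix (Fin n) (Fin n) ℂ}
    {F G : Fin n → Submodule ℂ (Fin n → ℂ)} (hm : DefinesPair π m F G) {i : Fin n} {j : Fin k}
    (hij : BlackNW π b (π.symm i) j) :
    checkerboardVariety π b F G ⊆ closure (planes m {w ∈ supportCoords π b |
      (∀ j, w (b.row j) j ≠ 0) ∧ w i j ≠ 0}) := by
  refine (checkerboardVariety_subset_closure hb.unimodal hm).trans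
    (closure_minimal ?_ isClosed_closure)
  refine (planes_supportCoords_subset_closure m
    (insert (i, j) (Set.range fun j => (b.row j, j))) ?_).trans (closure_mono (planes_subset ?_))
  · rintro _ (rfl | ⟨j, rfl⟩)
    · exact hij
    · exact hb.blackNW_pivot j
  · rintro w ⟨hw, h⟩ -
    exact ⟨w, ⟨hw, fun j => h _ (Or.inr ⟨j, rfl⟩), h _ (Or.inl rfl)⟩, rfl⟩

end LRHomotopy

open LRHomotopy in
theorem lemma3p3 {n k : ℕ} (σ : Equiv.Perm (Fin n)) (d r r' : Fin n) (s s' : Fin k)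
    (parent child : RedCheckers n k)
    (hparent : GameNode σ parent) (hσ : MidSort σ d r r')
    (hswap : SwapMove σ d r r' s s' parent child)
    (F : Fin n → Submodule ℂ (Fin n → ℂ)) (M : Matrix (Fin n) (Fin n) ℂ)
    (hFM : DefinesPair (nextPerm σ r r') M F (flagOf M)) :
    (∀ t : ℂ, t ≠ 0 →
      IsDenseIn (planes M (modifiedCoords σ d r r' s s' child t))
        (checkerboardVariety σ parent F (flagOf (movingBasis M r r' t)))) ∧
    IsDenseIn (planes M (modifiedCoords σ d r r' s s' child 0))
      (checkerboardVariety (nextPerm σ r r') child F (flagOf (movingBasis M r r' 0))) := by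
  obtain ⟨d₀, h₀⟩ := hparent.exists_isSortedNode (Nat.zero_lt_of_lt d.2)
  have hp := h₀.of_midSort hσ
  have hc := hswap.isSortedNode hp hσ
  have hR := hσ.next_le hswap.top.1.2.1
  refine ⟨fun t ht => ⟨?_, ?_⟩, ?_, ?_⟩
  · exact (planes_modifiedCoords_subset hσ hp hswap ht M).trans
      (planes_supportCoords_subset (definesPair_movingBasis hσ ht hFM))
  · refine (checkerboardVariety_subset_closure_generic hp (definesPair_movingBasis hσ ht hFM)
      (i := r') (j := s') ⟨hswap.ascending_le_col hσ, ?_⟩).trans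
      (closure_mono (planes_subset_modifiedCoords hσ hp hswap ht M))
    rwa [Equiv.apply_symm_apply]
  all_goals rw [show movingBasis M r r' 0 = M from if_pos rfl]
  · exact (planes_subset fun Y hY _ => ⟨Y, modifiedMatrix_zero_mem hσ hp hswap hY, rfl⟩).trans
      (planes_supportCoords_subset hFM)
  · refine (checkerboardVariety_subset_closure_generic hc hFM (i := r') (j := s') ⟨?_, ?_⟩).trans
      (closure_mono (planes_subset_modifiedCoords_zero hσ hp hswap M))
    · rw [hσ.symm_nextPerm_r', hswap.col_s']
      exact hp.le_col_of_row_eq hσ hswap.critical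
    · rwa [Equiv.apply_symm_apply, hswap.row_eq]
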